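/- **Setting.** Let $N\in\mathbb N$, and let $W\in L^1_{\mathrm{loc}}(\mathbb R^{dN};\mathbb R)$ with $W\ge 0$ almost everywhere. Let $\omega\ge 0$ be an injective self-adjoint operator on a complex Hilbert space $\mathfrak h$, and let $\mathfrak h_\omega$ be the Hilbert completion of $\bigcap_{k}\mathscr D(\omega^k)$ for the scalar product $\langle\,\cdot\,|\omega|\,\cdot\,\rangle$; $\omega^{1/2}$ extends to an isometry $\mathfrak h_\omega\to\mathfrak h$, and for $\lambda\in\mathscr D(\omega^{-1/2})$, $z\in\mathfrak h_\omega$ we write $\langle z|\lambda\rangle:=\langle\omega^{1/2}z|\omega^{-1/2}\lambda\rangle$ and $\langle z|\omega|z\rangle:=\|z\|^2_{\mathfrak h_\omega}$. Put $\mathscr H=L^2(\mathbb R^{dN})$. Consider one of the following three families of Hamiltonians $\mathcal H_z$, $z\in\mathfrak h_\omega$, understood as quadratic forms on the form domain $\mathscr Q(\mathcal K_0)=\{\psi\in H^1(\mathbb R^{dN}):\int W|\psi|^2<\infty\}$ of the free operator $\mathcal K_0$. * *Nelson model*, $d\in\{1,2,3\}$, $\lambda,\omega^{-1/2}\lambda\in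 L^\infty(\mathbb R^d;\mathfrak h)$: $\mathcal K_0=\sum_j(-\Delta_j)+W$ and $\mathcal H_z=\mathcal K_0+\sum_{j=1}^N 2\,\mathrm{Re}\langle z|\lambda(x_j)\rangle+\langle z|\omega|z\rangle$. * *Polaron*, $d\in\{1,2,3\}$, $\alpha>0$, $\mathfrak h=\mathfrak h_\omega=L^2(\mathbb R^d)$, $\omega=1$: $\mathcal K_0=\sum_j(-\Delta_j)+W$ and $\mathcal H_z=\mathcal K_0+\sum_{j=1}^N 2\,\mathrm{Re}\langle z|\lambda(x_j)\rangle+\|z\|^2$ with $\lambda(x;k)=\sqrt\alpha\,e^{-ik\cdot x}|k|^{-(d-1)/2}$. Here, for an arbitrary $\varrho>0$, the potential is understood as the form of $\sqrt\alpha\,(V_<+\nabla\cdot V_>)$ with the bounded functions $$V_<(x)=2\,\mathrm{Re}\int_{|k|\le\varrho}\frac{\overline{z(k)}e^{-ik\cdot x}}{|k|^{(d-1)/2}}\,dk,\qquad V_>(x)=-2\,\mathrm{Im}\int_{|k|>\varrho}\frac{\overline{z(k)}e^{-ik\cdot x}}{|k|^{(d+1)/2}}\frac{k}{|k|}\,dk,$$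 where $\langle\psi|(\nabla_j\cdot V_>)(x_j)|\psi\rangle:=-2\,\mathrm{Re}\int V_>(x_j)\cdot\overline\psi\,\nabla_j\psi$. * *Pauli–Fierz model*, $d=3$, $m_j>0$, $e\in\mathbb R$, $\lambda_{j,\ell},\omega^{\pm1/2}\lambda_{j,\ell}\in L^\infty(\mathbb R^3;\mathfrak h)$ for $1\le j\le N$, $1\le\ell\le 3$, and $\sum_\ell\partial_\ell\lambda_{j,\ell}=0$ in the sense of distributions: $\mathcal K_0=\sum_j\frac1{2m_j}(-\Delta_j)+W$ and $\mathcal H_z=\sum_{j=1}^N\frac1{2m_j}\bigl(-i\nabla_j+e\,a_{z,j}(x_j)\bigr)^2+W+\langle z|\omega|z\rangle$ with $(a_{z,j})_\ell(x)=2\,\mathrm{Re}\langle z|\lambda_{j,\ell}(x)\rangle$. **Quasi-classical energy.** $$E_{\mathrm{qc}}=\inf\bigl\{\langle\psi|\mathcal H_z|\psi\rangle:\ \psi\in\mathscr Q(\mathcal K_0),\ \|\psi\|=1,\ z\in\mathfrak h_\omega\bigr\}.$$ **Generalized states.** Let $\overline{\mathscr L}{}^1_+$ be the set of positive functionals in the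 weak-$*$ closure, in the dual of the bounded operators $\mathscr B(\mathscr H)$, of the trace class operators (acting by $B\mapsto\mathrm{tr}(\gamma B)$), and let $\overline{\mathscr L}{}^1_{+,1}$ be the subset of those of norm one; the pure generalized states are the extreme points of $\overline{\mathscr L}{}^1_{+,1}$. Let $\mathcal T=\mathcal K_0+1$. A state $\rho\in\overline{\mathscr L}{}^1_{+,1}$ is in the domain of $\mathcal T$ if there is $\rho_{\mathcal T}\in\overline{\mathscr L}{}^1_{+}$ with $\rho_{\mathcal T}[\mathcal T^{-1/2}B\mathcal T^{-1/2}]=\rho[B]$ for every $B\in\mathscr B(\mathscr H)$; then $\rho[\mathcal H_z]:=\rho_{\mathcal T}[\mathcal T^{-1/2}\mathcal H_z\mathcal T^{-1/2}]$, where $\mathcal T^{-1/2}\mathcal H_z\mathcal T^{-1/2}$ is the bounded operator with quadratic form $\varphi\mapsto\langle\mathcal T^{-1/2}\varphi|\mathcal H_z|\mathcal T^{-1/2}\varphi\rangle$. Let $$E_{\mathrm{gqc}}=\inf\bigl\{\rho[\mathcal H_z]:\ \rho\in\overline{\mathscr L}{}^1_{+,1}\text{ in the domain of }\mathcal T,\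 z\in\mathfrak h_\omega\bigr\},$$ the infimum being also over all admissible $\rho_{\mathcal T}$. **Generalized state-valued measures.** A generalized state-valued measure on $\mathfrak h_\omega$ is a map $\mathfrak n$ from the Borel sets of $\mathfrak h_\omega$ to $\overline{\mathscr L}{}^1_+$ that is countably additive for the dual norm; it is a probability measure if $\|\mathfrak n(\mathfrak h_\omega)\|=1$. It is in the domain of $\mathcal T$ if there is a generalized state-valued measure $\mathfrak n_{\mathcal T}$ with $\mathfrak n_{\mathcal T}(S)[\mathcal T^{-1/2}B\mathcal T^{-1/2}]=\mathfrak n(S)[B]$ for all Borel $S$ and all $B\in\mathscr B(\mathscr H)$. Let $$E_{\mathrm{gsvm}}=\inf\int_{\mathfrak h_\omega}d\mathfrak n_{\mathcal T}(z)\bigl[\mathcal T^{-1/2}\mathcal H_z\mathcal T^{-1/2}\bigr],$$ the infimum being over the generalized state-valued probability measures $\mathfrak n$ in the domain of $\mathcal T$ and the admissible $\mathfrak n_{\mathcal T}$ for which $z\mapsto\mathcal T^{-1/2}\mathcal H_z\mathcal T^{-1/2}$ is absolutely (Bochner) integrable with respect to the norm measure $S\mapsto\|\mathfrak n_{\mathcal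 T}(S)\|$. **Proposition (generalized quasi-classical ground state energy).** For each of the three models, as elements of $[-\infty,\infty]$, $$E_{\mathrm{qc}}=E_{\mathrm{gqc}}=E_{\mathrm{gsvm}},$$ and the value of $E_{\mathrm{gqc}}$ does not change if only pure generalized states are admitted. -/

import Mathlib

open MeasureTheory Filter Topology
open scoped ComplexOrder InnerProductSpace ComplexConjugate

noncomputable section

/-! ## Generalized states on the bounded operators of a Hilbert space -/

section GeneralizedStates

variable {H : Type*} [NormedAddCommGroup H] [InnerProductSpace ℂ H] [CompleteSpace H]

/-- The functionals `B ↦ tr (γ B)` with `γ` trace class, written through the nuclear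
representation `γ = ∑ₙ |vₙ⟩⟨uₙ|`, `∑ₙ ‖uₙ‖ ‖vₙ‖ < ∞`, of trace class operators. -/
def traceClassFunctionals (H : Type*) [NormedAddCommGroup H] [InnerProductSpace ℂ H] :
    Set (StrongDual ℂ (H →L[ℂ] H)) :=
  {F | ∃ u v : ℕ → H, Summable (fun n => ‖u n‖ * ‖v n‖) ∧
    ∀ B : H →L[ℂ] H, HasSum (fun n => inner ℂ (u n) (B (v n))) (F B)}

/-- Positive functionals in the weak-* closure of the trace class operators. -/
def generalizedStateCone (H : Type*) [NormedAddCommGroup H] [InnerProductSpace ℂ H] :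
    Set (StrongDual ℂ (H →L[ℂ] H)) :=
  {F | StrongDual.toWeakDual F ∈ closure (StrongDual.toWeakDual '' traceClassFunctionals H) ∧
    ∀ B : H →L[ℂ] H, B.IsPositive → 0 ≤ F B}

/-- Normalized generalized states. -/
def generalizedStates (H : Type*) [NormedAddCommGroup H] [InnerProductSpace ℂ H] :
    Set (StrongDual ℂ (H →L[ℂ] H)) :=
  {F | F ∈ generalizedStateCone H ∧ ‖F‖ = 1}

/-- Pure generalized states: the extreme points of the convex set of normalized ones. -/
def pureGeneralizedStates (H : Type*) [NormedAddCommGroup H] [InnerProductSpace ℂ H] :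
    Set (StrongDual ℂ (H →L[ℂ] H)) :=
  (generalizedStates H).extremePoints ℝ

/-- A generalized state-valued measure: a vector measure, countably additive for the dual norm,
with values in the cone of positive generalized states. -/
def IsGeneralizedStateMeasure {Z : Type*} [MeasurableSpace Z]
    (n : VectorMeasure Z (StrongDual ℂ (H →L[ℂ] H))) : Prop :=
  ∀ S, MeasurableSet S → n S ∈ generalizedStateCone H

/-- The evaluation pairing `(B, F) ↦ F B`. -/
def evalPairing (H : Type*) [NormedAddCommGroup H] [InnerProductSpace ℂ H] :
    (H →L[ℂ] H) →L[ℝ] StrongDual ℂ (H →L[ℂ] H) →L[ℝ] ℂ :=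
  LinearMap.mkContinuous₂
    (LinearMap.mk₂ ℝ (fun (B : H →L[ℂ] H) (F : StrongDual ℂ (H →L[ℂ] H)) => F B)
      (fun _ _ _ => map_add _ _ _)
      (fun c B F => by
        rw [RCLike.real_smul_eq_coe_smul (K := ℂ) c B, map_smul]
        exact (RCLike.real_smul_eq_coe_smul (K := ℂ) c (F B)).symm)
      (fun _ _ _ => rfl) (fun _ _ _ => rfl))
    1 (fun B F => by
      rw [one_mul, mul_comm]
      exact F.le_opNorm B)

end GeneralizedStates

/-! ## The three variational problems -/

/-- The quadratic forms of a particle system coupled to a classical field `z ∈ Z`: the common form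
domain `𝒬(𝒦₀) = 𝒬(ℋ_z)`, the form `ψ ↦ ⟨ψ|𝒦₀|ψ⟩` of the free particle Hamiltonian, and the form
`ψ ↦ ⟨ψ|ℋ_z|ψ⟩` of the quasi-classical Hamiltonian; only the values on the form domain matter. -/
structure QuasiClassicalForms (H Z : Type*) where
  formDomain : Set H
  freeForm : H → ℝ
  energyForm : Z → H → ℝ

namespace QuasiClassicalForms

variable {H Z : Type*} [NormedAddCommGroup H] [InnerProductSpace ℂ H] [CompleteSpace H]
  [MeasurableSpace Z] (M : QuasiClassicalForms H Z)

/-- `E_qc`: the infimum of `⟨ψ|ℋ_z|ψ⟩` over normalized `ψ` of finite energy and over `z`. -/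
def energyQC : EReal :=
  sInf {E | ∃ (ψ : H) (z : Z), ‖ψ‖ = 1 ∧ ψ ∈ M.formDomain ∧ E = ((M.energyForm z ψ : ℝ) : EReal)}

/-- `R = 𝒯^{-1/2}` for `𝒯 = 𝒦₀ + 1`: the positive bounded operator whose range is
`𝒟(𝒯^{1/2}) = 𝒬(𝒦₀)` and for which `‖𝒯^{1/2} ψ‖² = ⟨ψ|𝒦₀ + 1|ψ⟩` at `ψ = R φ`. -/
def IsInvSqrt (R : H →L[ℂ] H) : Prop :=
  R.IsPositive ∧ Set.range R = M.formDomain ∧ ∀ φ, M.freeForm (R φ) + ‖R φ‖ ^ 2 = ‖φ‖ ^ 2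

/-- `G` is the bounded operator `𝒯^{-1/2} ℋ_z 𝒯^{-1/2}`, where `R = 𝒯^{-1/2}`. -/
def IsSandwich (R : H →L[ℂ] H) (z : Z) (G : H →L[ℂ] H) : Prop :=
  ∀ φ, inner ℂ φ (G φ) = ((M.energyForm z (R φ) : ℝ) : ℂ)

/-- The generalized state `ρ` is in the domain of `𝒯 = 𝒦₀ + 1`, and `ρ[ℋ_z] = E`: there is a
positive generalized state `ρ_𝒯` with `ρ_𝒯[𝒯^{-1/2} B 𝒯^{-1/2}] = ρ[B]` for all bounded `B`, and
`ρ[ℋ_z] = ρ_𝒯[𝒯^{-1/2} ℋ_z 𝒯^{-1/2}]`. -/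
def HasGeneralizedEnergy (ρ : StrongDual ℂ (H →L[ℂ] H)) (z : Z) (E : ℝ) : Prop :=
  ∃ (R G : H →L[ℂ] H) (ρT : StrongDual ℂ (H →L[ℂ] H)),
    M.IsInvSqrt R ∧ M.IsSandwich R z G ∧ ρT ∈ generalizedStateCone H ∧
    (∀ B : H →L[ℂ] H, ρT (R ∘L B ∘L R) = ρ B) ∧ ρT G = (E : ℂ)

/-- `E_gqc`: the infimum of `ρ[ℋ_z]` over normalized generalized states `ρ` and over `z`. -/
def energyGQC : EReal :=
  sInf {E | ∃ (ρ : StrongDual ℂ (H →L[ℂ] H)) (z : Z) (e : ℝ),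
    ρ ∈ generalizedStates H ∧ M.HasGeneralizedEnergy ρ z e ∧ E = (e : EReal)}

/-- The variant of `E_gqc` in which only pure generalized states are admitted. -/
def energyGQCPure : EReal :=
  sInf {E | ∃ (ρ : StrongDual ℂ (H →L[ℂ] H)) (z : Z) (e : ℝ),
    ρ ∈ pureGeneralizedStates H ∧ M.HasGeneralizedEnergy ρ z e ∧ E = (e : EReal)}

/-- The generalized state-valued measure `n` is in the domain of `𝒯 = 𝒦₀ + 1`, the function
`z ↦ 𝒯^{-1/2} ℋ_z 𝒯^{-1/2}` is absolutely integrable with respect to `n_𝒯`, and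
`∫ dn(z)[ℋ_z] = ∫ dn_𝒯(z)[𝒯^{-1/2} ℋ_z 𝒯^{-1/2}] = E`. For measures with values in positive
functionals the variation is the norm measure `S ↦ ‖n_𝒯(S)‖`. -/
def HasGeneralizedMeasureEnergy (n : VectorMeasure Z (StrongDual ℂ (H →L[ℂ] H))) (E : ℝ) : Prop :=
  ∃ (R : H →L[ℂ] H) (G : Z → H →L[ℂ] H) (nT : VectorMeasure Z (StrongDual ℂ (H →L[ℂ] H))),
    M.IsInvSqrt R ∧ (∀ z, M.IsSandwich R z (G z)) ∧ IsGeneralizedStateMeasure nT ∧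
    (∀ S, MeasurableSet S → ∀ B : H →L[ℂ] H, nT S (R ∘L B ∘L R) = n S B) ∧
    nT.Integrable G ∧ nT.integral G (evalPairing H) = (E : ℂ)

/-- `E_gsvm`: the infimum of `∫ dn(z)[ℋ_z]` over generalized state-valued probability measures. -/
def energyGSVM : EReal :=
  sInf {E | ∃ (n : VectorMeasure Z (StrongDual ℂ (H →L[ℂ] H))) (e : ℝ),
    IsGeneralizedStateMeasure n ∧ ‖n Set.univ‖ = 1 ∧
    M.HasGeneralizedMeasureEnergy n e ∧ E = (e : EReal)}

end QuasiClassicalForms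

/-! ## The particle system -/

/-- Configurations `X = (x₁, …, x_N)` of `N` particles in `ℝᵈ`. -/
abbrev Config (N d : ℕ) : Type := Fin N → EuclideanSpace ℝ (Fin d)

/-- `L²(ℝ^{dN})`. -/
abbrev ParticleSpace (N d : ℕ) : Type := Lp ℂ 2 (volume : Measure (Config N d))

/-- The unit vector of `ℝ^{dN}` for the `l`-th coordinate of the `j`-th particle. -/
def coordVec {N d : ℕ} (j : Fin N) (l : Fin d) : Config N d :=
  Pi.single j (EuclideanSpace.single l (1 : ℝ))

/-- `g` is the weak partial derivative `∂_{j,l} ψ`. -/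
def HasWeakPartial {N d : ℕ} (ψ : ParticleSpace N d) (j : Fin N) (l : Fin d)
    (g : ParticleSpace N d) : Prop :=
  ∀ φ : Config N d → ℝ, ContDiff ℝ (⊤ : ℕ∞) φ → HasCompactSupport φ →
    ∫ X, (fderiv ℝ φ X (coordVec j l)) • ψ X = -∫ X, φ X • g X

open Classical in
/-- The weak partial derivative `∂_{j,l} ψ` (zero if there is none in `L²`). -/
def weakPartial {N d : ℕ} (ψ : ParticleSpace N d) (j : Fin N) (l : Fin d) : ParticleSpace N d :=
  if h : ∃ g, HasWeakPartial ψ j l g then h.choose else 0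

/-- The form domain of `-Δ + W`: all `ψ ∈ H¹(ℝ^{dN})` with `∫ W |ψ|² < ∞`. -/
def freeFormDomain {N d : ℕ} (W : Config N d → ℝ) : Set (ParticleSpace N d) :=
  {ψ | (∀ j l, ∃ g, HasWeakPartial ψ j l g) ∧ Integrable (fun X => W X * ‖ψ X‖ ^ 2)}

/-- The form of `𝒦₀ = ∑ⱼ cⱼ (-Δⱼ) + W`. -/
def freeFormOf {N d : ℕ} (c : Fin N → ℝ) (W : Config N d → ℝ) (ψ : ParticleSpace N d) : ℝ :=
  (∑ j, c j * ∑ l, ‖weakPartial ψ j l‖ ^ 2) + ∫ X, W X * ‖ψ X‖ ^ 2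

/-! ## The field and its phase space `𝔥_ω` -/

/-- A nonnegative self-adjoint, possibly unbounded, operator. -/
def IsNonnegSelfAdjoint {h : Type*} [NormedAddCommGroup h] [InnerProductSpace ℂ h]
    [CompleteSpace h] (A : h →ₗ.[ℂ] h) : Prop :=
  IsSelfAdjoint A ∧ ∀ x : A.domain, 0 ≤ (inner ℂ (x : h) (A x)).re

/-- The one-excitation energy: an injective nonnegative self-adjoint operator `ω`, together with
its (unique) nonnegative self-adjoint square root `ω^{1/2}`. -/
structure Dispersion (h : Type*) [NormedAddCommGroup h] [InnerProductSpace ℂ h]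
    [CompleteSpace h] where
  op : h →ₗ.[ℂ] h
  sqrt : h →ₗ.[ℂ] h
  op_nonneg : IsNonnegSelfAdjoint op
  op_injective : ∀ x : op.domain, op x = 0 → (x : h) = 0
  sqrt_nonneg : IsNonnegSelfAdjoint sqrt
  mem_op_domain_iff : ∀ x : h,
    x ∈ op.domain ↔ ∃ hx : x ∈ sqrt.domain, sqrt ⟨x, hx⟩ ∈ sqrt.domain
  op_eq : ∀ (x : op.domain) (hx : (x : h) ∈ sqrt.domain) (hx' : sqrt ⟨x, hx⟩ ∈ sqrt.domain),
    op x = sqrt ⟨sqrt ⟨x, hx⟩, hx'⟩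

namespace Dispersion

variable {h : Type*} [NormedAddCommGroup h] [InnerProductSpace ℂ h] [CompleteSpace h]
  (ω : Dispersion h)

/-- The domain of `ω ^ k`. -/
def powDomain : ℕ → Submodule ℂ h
  | 0 => ⊤
  | k + 1 => ((powDomain k).comap ω.op.toFun).map ω.op.domain.subtype

/-- The space `⋂ₖ 𝒟(ω ^ k)`. -/
def SmoothVec : Type _ := ↥(⨅ k, ω.powDomain k)

instance : AddCommGroup ω.SmoothVec := inferInstanceAs (AddCommGroup ↥(⨅ k, ω.powDomain k))

instance : Module ℂ ω.SmoothVec := inferInstanceAs (Module ℂ ↥(⨅ k, ω.powDomain k))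

/-- The inclusion of `⋂ₖ 𝒟(ω ^ k)` in `𝔥`. -/
def smoothIncl : ω.SmoothVec →ₗ[ℂ] h := (⨅ k, ω.powDomain k).subtype

theorem smoothIncl_mem (x : ω.SmoothVec) : ω.smoothIncl x ∈ ω.op.domain := by
  have hx : ω.smoothIncl x ∈ ω.powDomain 1 :=
    (Submodule.mem_iInf _).1 (show ω.smoothIncl x ∈ ⨅ k, ω.powDomain k from x.2) 1
  obtain ⟨y, -, hy⟩ := hx
  rw [← hy]
  exact y.2

theorem smoothIncl_mem_sqrt (x : ω.SmoothVec) : ω.smoothIncl x ∈ ω.sqrt.domain :=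
  ((ω.mem_op_domain_iff _).1 (ω.smoothIncl_mem x)).1

/-- `ω` on `⋂ₖ 𝒟(ω ^ k)`. -/
def smoothOp : ω.SmoothVec →ₗ[ℂ] h :=
  ω.op.toFun ∘ₗ ω.smoothIncl.codRestrict ω.op.domain ω.smoothIncl_mem

/-- `ω^{1/2}` on `⋂ₖ 𝒟(ω ^ k)`. -/
def smoothSqrt : ω.SmoothVec →ₗ[ℂ] h :=
  ω.sqrt.toFun ∘ₗ ω.smoothIncl.codRestrict ω.sqrt.domain ω.smoothIncl_mem_sqrt

theorem inner_smoothOp (x y : ω.SmoothVec) :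
    inner ℂ (ω.smoothIncl x) (ω.smoothOp y) = inner ℂ (ω.smoothSqrt x) (ω.smoothSqrt y) := by
  obtain ⟨hy, hy'⟩ := (ω.mem_op_domain_iff _).1 (ω.smoothIncl_mem y)
  have h1 : ω.smoothOp y = ω.sqrt ⟨ω.smoothSqrt y, hy'⟩ :=
    ω.op_eq ⟨ω.smoothIncl y, ω.smoothIncl_mem y⟩ hy hy'
  have hs := ω.sqrt_nonneg.1
  have hf := LinearPMap.adjoint_isFormalAdjoint hs.dense_domain
  rw [LinearPMap.isSelfAdjoint_def.1 hs] at hf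
  rw [h1]
  exact (hf ⟨ω.smoothIncl x, ω.smoothIncl_mem_sqrt x⟩ ⟨ω.smoothSqrt y, hy'⟩).symm

/-- The scalar product `⟨x|ω|y⟩` on `⋂ₖ 𝒟(ω ^ k)`. -/
instance smoothCore : PreInnerProductSpace.Core ℂ ω.SmoothVec where
  inner x y := inner ℂ (ω.smoothIncl x) (ω.smoothOp y)
  conj_inner_symm x y := by simp only [inner_smoothOp, inner_conj_symm]
  re_inner_nonneg x := by simp only [inner_smoothOp]; exact inner_self_nonneg
  add_left x y z := by simp only [map_add, inner_add_left]
  smul_left x y r := by simp only [map_smul, inner_smul_left]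

instance : SeminormedAddCommGroup ω.SmoothVec :=
  InnerProductSpace.Core.toSeminormedAddCommGroup (𝕜 := ℂ)

instance : InnerProductSpace ℂ ω.SmoothVec := InnerProductSpace.ofCore ω.smoothCore

/-- The phase space `𝔥_ω`: the Hilbert completion of `⋂ₖ 𝒟(ω ^ k)` for `⟨·|ω|·⟩`. -/
abbrev PhaseSpace : Type _ := UniformSpace.Completion ω.SmoothVec

instance : MeasurableSpace ω.PhaseSpace := borel _

theorem norm_smoothSqrt (x : ω.SmoothVec) : ‖ω.smoothSqrt x‖ = ‖x‖ := by
  have h1 : ‖ω.smoothSqrt x‖ ^ 2 = ‖x‖ ^ 2 := by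
    rw [← inner_self_eq_norm_sq (𝕜 := ℂ), ← inner_self_eq_norm_sq (𝕜 := ℂ), ← inner_smoothOp]
    rfl
  exact (sq_eq_sq₀ (norm_nonneg _) (norm_nonneg _)).1 h1

/-- The continuous extension of `ω^{1/2}` to `𝔥_ω`, with values in `𝔥`. -/
def sqrtExt : ω.PhaseSpace →L[ℂ] h :=
  (ω.smoothSqrt.mkContinuous 1 fun x => by rw [one_mul, norm_smoothSqrt]).extend
    (UniformSpace.Completion.toComplL : ω.SmoothVec →L[ℂ] ω.PhaseSpace)

/-- `ξ = ω^{-1/2} λ`. -/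
def IsInvSqrtOf (ξ lam : h) : Prop := ∃ hξ : ξ ∈ ω.sqrt.domain, ω.sqrt ⟨ξ, hξ⟩ = lam

end Dispersion

/-! ## The Nelson model -/

/-- A form factor `λ` with `λ, ω^{-1/2} λ ∈ L^∞(ℝᵈ; 𝔥)`. -/
structure NelsonFormFactor {h : Type*} [NormedAddCommGroup h] [InnerProductSpace ℂ h]
    [CompleteSpace h] (ω : Dispersion h) (d : ℕ) where
  lam : EuclideanSpace ℝ (Fin d) → h
  xi : EuclideanSpace ℝ (Fin d) → h
  memLp_lam : MemLp lam ⊤ volume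
  memLp_xi : MemLp xi ⊤ volume
  xi_eq : ∀ᵐ x, ω.IsInvSqrtOf (xi x) (lam x)

section Nelson

variable {h : Type*} [NormedAddCommGroup h] [InnerProductSpace ℂ h] [CompleteSpace h]
  {ω : Dispersion h} {d : ℕ}

/-- `𝒱_z(x) = 2 Re ⟨z|λ(x)⟩ = 2 Re ⟨ω^{1/2} z|ω^{-1/2} λ(x)⟩`, for `z ∈ 𝔥_ω`. -/
def nelsonPotential (F : NelsonFormFactor ω d) (z : ω.PhaseSpace)
    (x : EuclideanSpace ℝ (Fin d)) : ℝ :=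
  2 * (inner ℂ (ω.sqrtExt z) (F.xi x)).re

/-- `ℋ_z = ∑ⱼ (-Δⱼ + 𝒱_z(xⱼ)) + W + ⟨z|ω|z⟩`. -/
def nelsonModel {N : ℕ} (W : Config N d → ℝ) (F : NelsonFormFactor ω d) :
    QuasiClassicalForms (ParticleSpace N d) ω.PhaseSpace where
  formDomain := freeFormDomain W
  freeForm := freeFormOf (fun _ => 1) W
  energyForm z ψ := freeFormOf (fun _ => 1) W ψ
    + (∑ j, ∫ X, nelsonPotential F z (X j) * ‖ψ X‖ ^ 2) + ‖z‖ ^ 2 * ‖ψ‖ ^ 2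

end Nelson

/-! ## The polaron -/

/-- The phase space of the polaron: `𝔥_ω = 𝔥 = L²(ℝᵈ)`, since `ω = 1`. -/
abbrev PolaronField (d : ℕ) : Type := Lp ℂ 2 (volume : Measure (EuclideanSpace ℝ (Fin d)))

instance (d : ℕ) : MeasurableSpace (PolaronField d) := borel _

/-- The bounded function `2 Re ∫_{|k| ≤ ϱ} z̄(k) e^{-ik·x} |k|^{-(d-1)/2} dk`. -/
def polaronLow {d : ℕ} (r : ℝ) (z : PolaronField d) (x : EuclideanSpace ℝ (Fin d)) : ℝ :=
  2 * (∫ k in {k : EuclideanSpace ℝ (Fin d) | ‖k‖ ≤ r},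
    conj (z k) * Complex.exp (-Complex.I * ((inner ℝ k x : ℝ) : ℂ))
      * ((‖k‖ ^ (-((d : ℝ) - 1) / 2) : ℝ) : ℂ)).re

/-- The components of the bounded vector field
`-2 Im ∫_{|k| > ϱ} z̄(k) e^{-ik·x} |k|^{-(d+1)/2} (k / |k|) dk`; its divergence is
`2 Re ∫_{|k| > ϱ} z̄(k) e^{-ik·x} |k|^{-(d-1)/2} dk`. -/
def polaronHigh {d : ℕ} (r : ℝ) (z : PolaronField d) (l : Fin d)
    (x : EuclideanSpace ℝ (Fin d)) : ℝ :=
  -2 * (∫ k in {k : EuclideanSpace ℝ (Fin d) | r < ‖k‖},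
    conj (z k) * Complex.exp (-Complex.I * ((inner ℝ k x : ℝ) : ℂ))
      * ((‖k‖ ^ (-((d : ℝ) + 1) / 2) * (k l / ‖k‖) : ℝ) : ℂ)).im

/-- The form of the polaron Hamiltonian `∑ⱼ (-Δⱼ + 𝒱_z(xⱼ)) + W + ‖z‖²` with
`𝒱_z(x) = 2 Re ⟨z|λ(x)⟩`, `λ(x; k) = √α e^{-ik·x} |k|^{-(d-1)/2}`, where
`𝒱_z = √α (V_< + ∇·V_>)` is split at `|k| = ϱ` and the divergence is moved to `|ψ|²` by parts:
`⟨ψ|(∇ⱼ·V_>)(xⱼ)|ψ⟩ = -2 Re ∫ V_>(xⱼ)·ψ̄ ∇ⱼψ`. -/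
def polaronModel {N d : ℕ} (W : Config N d → ℝ) (α r : ℝ) :
    QuasiClassicalForms (ParticleSpace N d) (PolaronField d) where
  formDomain := freeFormDomain W
  freeForm := freeFormOf (fun _ => 1) W
  energyForm z ψ := freeFormOf (fun _ => 1) W ψ
    + √α * (∑ j, ((∫ X, polaronLow r z (X j) * ‖ψ X‖ ^ 2)
      - 2 * ∑ l, ∫ X, polaronHigh r z l (X j) * (conj (ψ X) * weakPartial ψ j l X).re))
    + ‖z‖ ^ 2 * ‖ψ‖ ^ 2

/-! ## The Pauli-Fierz model -/

/-- Form factors `λ_{j,l}` with `λ_{j,l}, ω^{±1/2} λ_{j,l} ∈ L^∞(ℝ³; 𝔥)` in the Coulomb gauge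
`∇ⱼ·λⱼ = 0` (in the sense of distributions). -/
structure PauliFierzFormFactor {h : Type*} [NormedAddCommGroup h] [InnerProductSpace ℂ h]
    [CompleteSpace h] (ω : Dispersion h) (N : ℕ) where
  lam : Fin N → Fin 3 → EuclideanSpace ℝ (Fin 3) → h
  xi : Fin N → Fin 3 → EuclideanSpace ℝ (Fin 3) → h
  zeta : Fin N → Fin 3 → EuclideanSpace ℝ (Fin 3) → h
  memLp_lam : ∀ j l, MemLp (lam j l) ⊤ volume
  memLp_xi : ∀ j l, MemLp (xi j l) ⊤ volume
  memLp_zeta : ∀ j l, MemLp (zeta j l) ⊤ volume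
  xi_eq : ∀ j l, ∀ᵐ x, ω.IsInvSqrtOf (xi j l x) (lam j l x)
  zeta_eq : ∀ j l, ∀ᵐ x, ω.IsInvSqrtOf (lam j l x) (zeta j l x)
  coulomb : ∀ j, ∀ φ : EuclideanSpace ℝ (Fin 3) → ℝ, ContDiff ℝ (⊤ : ℕ∞) φ → HasCompactSupport φ →
    ∑ l, ∫ x, (fderiv ℝ φ x (EuclideanSpace.single l 1)) • lam j l x = 0

section PauliFierz

variable {h : Type*} [NormedAddCommGroup h] [InnerProductSpace ℂ h] [CompleteSpace h]
  {ω : Dispersion h} {N : ℕ}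

/-- The `l`-th component of the classical field `a_{z,j}(x) = 2 Re ⟨z|λⱼ(x)⟩`. -/
def pauliFierzField (F : PauliFierzFormFactor ω N) (z : ω.PhaseSpace) (j : Fin N) (l : Fin 3)
    (x : EuclideanSpace ℝ (Fin 3)) : ℝ :=
  2 * (inner ℂ (ω.sqrtExt z) (F.xi j l x)).re

/-- `ℋ_z = ∑ⱼ (2mⱼ)⁻¹ (-i∇ⱼ + e a_{z,j}(xⱼ))² + W + ⟨z|ω|z⟩`. -/
def pauliFierzModel (W : Config N 3 → ℝ) (mass : Fin N → ℝ) (e : ℝ)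
    (F : PauliFierzFormFactor ω N) : QuasiClassicalForms (ParticleSpace N 3) ω.PhaseSpace where
  formDomain := freeFormDomain W
  freeForm := freeFormOf (fun j => 1 / (2 * mass j)) W
  energyForm z ψ := (∑ j, 1 / (2 * mass j) * ∑ l, ∫ X,
      ‖-Complex.I * weakPartial ψ j l X + ((e * pauliFierzField F z j l (X j) : ℝ) : ℂ) * ψ X‖ ^ 2)
    + (∫ X, W X * ‖ψ X‖ ^ 2) + ‖z‖ ^ 2 * ‖ψ‖ ^ 2

end PauliFierz

end

/-! Write `R` for `𝒯^{-1/2}` and `G z` for the bounded operator `R ℋ_z R`. If a real `E` does not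
exceed the quasi-classical energy, then `⟨Rφ|ℋ_z|Rφ⟩ ≥ E ‖Rφ‖²` for all `φ`, by scaling; that is, `G
z - E R²` is a positive operator (`IsSandwich.sub_smul_isPositive`). A positive functional `ρ_𝒯`
preserves this inequality, and `ρ_𝒯[R²] = ρ[1] = 1`, so `ρ[ℋ_z] ≥ E`. The bound is uniform in `z`,
so it can also be integrated against a state-valued measure
(`IsGeneralizedStateMeasure.apply_le_integral`).

Conversely, every `ψ` in the form domain is `Rφ`. The vector state of `ψ` has the vector functional
of `φ` as its `ρ_𝒯` and reproduces `⟨ψ|ℋ_z|ψ⟩`. Vector states are pure, and a point mass at `z`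
turns them into measures, so none of the infima lies above the quasi-classical one.

It remains to construct `R` and to show that `G z` is bounded. The form domain with its form norm is
realized as a closed subspace of a finite sum of copies of `L²`, namely the graph of `ψ ↦ (√W ψ, √cⱼ
∂ψ)`. For the injection `J` of this Hilbert space with dense range in `L²`, `R = (J J*)^{1/2}`
equals `J U` with `U` a surjective isometry (`exists_isPositive_eq_comp_isometry`). Hence `∂R` and
`√W R` are bounded, and in each model `⟨Rφ|ℋ_z|Rφ⟩` is a finite sum of forms built from these
operators and multiplication by bounded functions. -/

/-! ## Positive functionals on the bounded operators -/

section PositiveFunctionals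

variable {H : Type*} [NormedAddCommGroup H] [InnerProductSpace ℂ H] [CompleteSpace H]
  {F : StrongDual ℂ (H →L[ℂ] H)}

/-- A functional that is nonnegative on positive operators, as a positive linear map. -/
noncomputable def positiveMapOfFunctional (F : StrongDual ℂ (H →L[ℂ] H))
    (hF : ∀ B : H →L[ℂ] H, B.IsPositive → 0 ≤ F B) : (H →L[ℂ] H) →ₚ[ℂ] ℂ :=
  PositiveLinearMap.mk₀ F.toLinearMap fun B hB =>
    hF B ((ContinuousLinearMap.nonneg_iff_isPositive B).1 hB)

/-- The Cauchy-Schwarz inequality for positive functionals. -/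
theorem norm_apply_star_mul_sq_le (hF : ∀ B : H →L[ℂ] H, B.IsPositive → 0 ≤ F B)
    (A B : H →L[ℂ] H) :
    ‖F (star A * B)‖ ^ 2 ≤ (F (star A * A)).re * (F (star B * B)).re := by
  let f := positiveMapOfFunctional F hF
  -- The pre-GNS inner product of `A` and `B` is `F (star A * B)`.
  have h1 : ‖F (star A * B)‖ ≤ ‖f.toPreGNS A‖ * ‖f.toPreGNS B‖ :=
    norm_inner_le_norm (𝕜 := ℂ) (f.toPreGNS A) (f.toPreGNS B)
  have h2 : ∀ C : H →L[ℂ] H, ‖f.toPreGNS C‖ ^ 2 = (F (star C * C)).re := fun C =>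
    congrArg Complex.re (f.preGNS_norm_sq (f.toPreGNS C)) |> fun h => by
      rw [← Complex.ofReal_pow, Complex.ofReal_re] at h
      exact h
  rw [← h2, ← h2, ← mul_pow]
  gcongr

/-- Cauchy-Schwarz against the identity, followed by the operator inequality `B* B ≤ ‖B‖² 1`. -/
theorem norm_apply_le_re_apply_one_mul (hF : ∀ B : H →L[ℂ] H, B.IsPositive → 0 ≤ F B)
    (B : H →L[ℂ] H) : ‖F B‖ ≤ (F 1).re * ‖B‖ := by
  have h0 : 0 ≤ (F 1).re := (Complex.nonneg_iff.1 (hF 1 ContinuousLinearMap.isPositive_one)).1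
  have h1 := norm_apply_star_mul_sq_le hF 1 B
  rw [star_one, one_mul, one_mul] at h1
  have h2 : (F (star B * B)).re ≤ ‖B‖ ^ 2 * (F 1).re := by
    have h3 : ((‖B‖ ^ 2 : ℝ) • (1 : H →L[ℂ] H) - star B * B).IsPositive := by
      rw [← ContinuousLinearMap.nonneg_iff_isPositive, sub_nonneg]
      have := CStarAlgebra.star_mul_le_algebraMap_norm_sq (a := B)
      rwa [Algebra.algebraMap_eq_smul_one] at this
    have h4 := (Complex.nonneg_iff.1 (hF _ h3)).1
    rw [map_sub, RCLike.real_smul_eq_coe_smul (K := ℂ), map_smul] at h4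
    rw [Complex.sub_re, smul_eq_mul, RCLike.ofReal_eq_complex_ofReal, Complex.re_ofReal_mul] at h4
    linarith
  rw [← sq_le_sq₀ (norm_nonneg _) (by positivity)]
  calc ‖F B‖ ^ 2 ≤ _ := h1
    _ ≤ (F 1).re * (‖B‖ ^ 2 * (F 1).re) := by gcongr
    _ = _ := by ring

/-- The norm of a positive functional is its value at the identity. -/
theorem norm_eq_re_apply_one (hF : ∀ B : H →L[ℂ] H, B.IsPositive → 0 ≤ F B) :
    ‖F‖ = (F 1).re := by
  have h0 : 0 ≤ (F 1).re := (Complex.nonneg_iff.1 (hF 1 ContinuousLinearMap.isPositive_one)).1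
  refine le_antisymm (F.opNorm_le_bound h0 (norm_apply_le_re_apply_one_mul hF)) ?_
  calc (F 1).re ≤ ‖F 1‖ := Complex.re_le_norm _
    _ ≤ ‖F‖ * ‖(1 : H →L[ℂ] H)‖ := F.le_opNorm _
    -- Only an inequality, because the identity of the zero space has norm zero.
    _ ≤ ‖F‖ * 1 := by gcongr; exact ContinuousLinearMap.norm_id_le
    _ = ‖F‖ := mul_one _

theorem apply_one_eq_norm (hF : ∀ B : H →L[ℂ] H, B.IsPositive → 0 ≤ F B) :
    F 1 = (‖F‖ : ℂ) := by
  rw [norm_eq_re_apply_one hF]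
  apply Complex.ext
  · simp
  · simpa using (Complex.nonneg_iff.1 (hF 1 ContinuousLinearMap.isPositive_one)).2.symm

end PositiveFunctionals

/-! ## Vector states -/

section VectorStates

variable {H : Type*} [NormedAddCommGroup H] [InnerProductSpace ℂ H]

/-- The functional `B ↦ ⟨ψ|B|ψ⟩`. -/
noncomputable def vectorFunctional (ψ : H) : StrongDual ℂ (H →L[ℂ] H) :=
  (innerSL ℂ ψ).comp (ContinuousLinearMap.apply ℂ H ψ)

@[simp]
theorem vectorFunctional_apply (ψ : H) (B : H →L[ℂ] H) :
    vectorFunctional ψ B = inner ℂ ψ (B ψ) := rfl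

/-- The trace class operator is `|ψ⟩⟨ψ|`, whose nuclear representation has a single nonzero term. -/
theorem vectorFunctional_mem_traceClassFunctionals (ψ : H) :
    vectorFunctional ψ ∈ traceClassFunctionals H := by
  classical
  refine ⟨Pi.single 0 ψ, Pi.single 0 ψ, ?_, fun B => ?_⟩
  · refine summable_of_ne_finset_zero (s := {0}) fun n hn => ?_
    rw [Finset.mem_singleton] at hn
    simp [Pi.single_eq_of_ne hn]
  · have := hasSum_single (f := fun n : ℕ => inner ℂ ((Pi.single 0 ψ : ℕ → H) n)
      (B ((Pi.single 0 ψ : ℕ → H) n))) 0 fun n hn => by simp [Pi.single_eq_of_ne hn]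
    simpa using this

theorem vectorFunctional_mem_cone (ψ : H) : vectorFunctional ψ ∈ generalizedStateCone H := by
  refine ⟨subset_closure ⟨_, vectorFunctional_mem_traceClassFunctionals ψ, rfl⟩, fun B hB => ?_⟩
  exact hB.inner_nonneg_right ψ

variable [CompleteSpace H]

theorem norm_vectorFunctional (ψ : H) : ‖vectorFunctional ψ‖ = ‖ψ‖ ^ 2 := by
  rw [norm_eq_re_apply_one (vectorFunctional_mem_cone ψ).2]
  simpa using inner_self_eq_norm_sq (𝕜 := ℂ) ψ

theorem vectorFunctional_mem_generalizedStates {ψ : H} (hψ : ‖ψ‖ = 1) :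
    vectorFunctional ψ ∈ generalizedStates H :=
  ⟨vectorFunctional_mem_cone ψ, by rw [norm_vectorFunctional, hψ, one_pow]⟩

/-- A generalized state whose value at the projection onto a unit vector `ψ` is one is the vector
state of `ψ`. -/
theorem eq_vectorFunctional_of_apply_rankOne {ψ : H} (hψ : ‖ψ‖ = 1)
    {F : StrongDual ℂ (H →L[ℂ] H)} (hF : F ∈ generalizedStates H)
    (hFψ : F (InnerProductSpace.rankOne ℂ ψ ψ) = 1) : F = vectorFunctional ψ := by
  set P : H →L[ℂ] H := InnerProductSpace.rankOne ℂ ψ ψ with hP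
  have hpos := hF.1.2
  have h1 : F 1 = 1 := by rw [apply_one_eq_norm hpos, hF.2, Complex.ofReal_one]
  have hPP : P * P = P := by
    ext x
    simp [hP, hψ]
  have hPs : star P = P := by
    rw [ContinuousLinearMap.star_eq_adjoint]
    simp [hP]
  have hQ : star (1 - P) * (1 - P) = 1 - P := by
    rw [star_sub, star_one, hPs, sub_mul, mul_sub, mul_sub, hPP]
    simp
  have hQ0 : F (1 - P) = 0 := by rw [map_sub, h1, hFψ, sub_self]
  -- Since `1 - P` is a projection on which `F` vanishes, Cauchy-Schwarz annihilates every product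
  -- with a factor `1 - P` on the left or on the right. Only the corner `P B P`, a multiple of `P`,
  -- survives.
  have hL : ∀ B : H →L[ℂ] H, F ((1 - P) * B) = 0 := fun B => by
    have h := norm_apply_star_mul_sq_le hpos (1 - P) B
    rw [hQ, hQ0, Complex.zero_re, zero_mul, star_sub, star_one, hPs] at h
    exact norm_eq_zero.1 (pow_eq_zero_iff two_ne_zero |>.1 (le_antisymm h (by positivity)))
  have hR : ∀ B : H →L[ℂ] H, F (B * (1 - P)) = 0 := fun B => by
    have h := norm_apply_star_mul_sq_le hpos (star B) (1 - P)
    rw [hQ, hQ0, Complex.zero_re, mul_zero, star_star] at h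
    exact norm_eq_zero.1 (pow_eq_zero_iff two_ne_zero |>.1 (le_antisymm h (by positivity)))
  ext B
  have hB : B = (1 - P) * B + P * B * (1 - P) + P * B * P := by noncomm_ring
  have hPBP : P * B * P = inner ℂ ψ (B ψ) • P := by
    ext x
    simp [hP, smul_smul, mul_comm]
  calc F B = F ((1 - P) * B + P * B * (1 - P) + P * B * P) := by rw [← hB]
    _ = vectorFunctional ψ B := by
      rw [map_add, map_add, hL, hR, hPBP, map_smul, hFψ, vectorFunctional_apply]
      simp

theorem re_apply_rankOne_le_one {ψ : H} (hψ : ‖ψ‖ = 1) {F : StrongDual ℂ (H →L[ℂ] H)}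
    (hF : F ∈ generalizedStates H) : (F (InnerProductSpace.rankOne ℂ ψ ψ)).re ≤ 1 := by
  calc (F (InnerProductSpace.rankOne ℂ ψ ψ)).re
      ≤ ‖F (InnerProductSpace.rankOne ℂ ψ ψ)‖ := Complex.re_le_norm _
    _ ≤ ‖F‖ * ‖InnerProductSpace.rankOne ℂ ψ ψ‖ := F.le_opNorm _
    _ = 1 := by rw [hF.2, InnerProductSpace.norm_rankOne, hψ]; norm_num

/-- Vector states are pure generalized states. -/
theorem vectorFunctional_mem_pureGeneralizedStates {ψ : H} (hψ : ‖ψ‖ = 1) :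
    vectorFunctional ψ ∈ pureGeneralizedStates H := by
  rw [pureGeneralizedStates, mem_extremePoints]
  have key : ∀ F ∈ generalizedStates H, ∀ G ∈ generalizedStates H, ∀ a b : ℝ, 0 < a → 0 < b →
      a + b = 1 → a • F + b • G = vectorFunctional ψ → F = vectorFunctional ψ := by
    intro F hF G hG a b ha hb hab h
    -- At the projection onto `ψ` the vector state takes the value one, a proper convex average of
    -- two numbers that are at most one; hence both are one.
    refine eq_vectorFunctional_of_apply_rankOne hψ hF ?_
    have hP := InnerProductSpace.isPositive_rankOne_self (𝕜 := ℂ) ψ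
    have hFP := Complex.nonneg_iff.1 (hF.1.2 _ hP)
    have hFl := re_apply_rankOne_le_one hψ hF
    have hGl := re_apply_rankOne_le_one hψ hG
    have h2 := congrArg (fun f : StrongDual ℂ (H →L[ℂ] H) =>
      (f (InnerProductSpace.rankOne ℂ ψ ψ)).re) h
    simp [hψ] at h2
    apply Complex.ext
    · rw [Complex.one_re]
      nlinarith
    · simpa using hFP.2.symm
  refine ⟨vectorFunctional_mem_generalizedStates hψ, fun F hF G hG h => ?_⟩
  obtain ⟨a, b, ha, hb, hab, h⟩ := h
  exact ⟨key F hF G hG a b ha hb hab h,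
    key G hG F hF b a hb ha (by linarith) (by rw [add_comm, h])⟩

end VectorStates

/-! ## Generalized state-valued measures -/

section StateMeasures

variable {H Z : Type*} [NormedAddCommGroup H] [InnerProductSpace ℂ H]
  [MeasurableSpace Z]

theorem evalPairing_apply (B : H →L[ℂ] H) (F : StrongDual ℂ (H →L[ℂ] H)) :
    evalPairing H B F = F B := rfl

theorem isGeneralizedStateMeasure_dirac {F : StrongDual ℂ (H →L[ℂ] H)}
    (hF : F ∈ generalizedStateCone H) (h0 : 0 ∈ generalizedStateCone H) (z : Z) :
    IsGeneralizedStateMeasure (VectorMeasure.dirac z F) := by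
  intro S hS
  by_cases hz : z ∈ S
  · rwa [VectorMeasure.dirac_apply_of_mem hS hz]
  · rwa [VectorMeasure.dirac_apply_of_notMem hz]

theorem zero_mem_generalizedStateCone : 0 ∈ generalizedStateCone H := by
  have : vectorFunctional (0 : H) = 0 := by ext; simp
  exact this ▸ vectorFunctional_mem_cone (0 : H)

variable [CompleteSpace H]

/-- A generalized state-valued measure has finite variation, since the norm is additive on
positive functionals. -/
theorem IsGeneralizedStateMeasure.isFiniteMeasure_variation
    {n : VectorMeasure Z (StrongDual ℂ (H →L[ℂ] H))} (hn : IsGeneralizedStateMeasure n) :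
    IsFiniteMeasure (VectorMeasure.variation (V := StrongDual ℂ (H →L[ℂ] H)) n) := by
  -- Evaluation at the identity is linear and computes the norm on the cone, so `S ↦ ‖n S‖` is a
  -- nonnegative finite signed measure. It dominates the variation.
  let L : StrongDual ℂ (H →L[ℂ] H) →L[ℝ] ℝ := Complex.reCLM.comp (evalPairing H 1)
  let s : SignedMeasure Z := n.mapRange L.toLinearMap.toAddMonoidHom L.continuous
  have hs : ∀ S, MeasurableSet S → s S = ‖n S‖ := fun S hS =>
    (norm_eq_re_apply_one (hn S hS).2).symm
  have h0 : VectorMeasure.restrict (0 : SignedMeasure Z) Set.univ ≤ s.restrict Set.univ := by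
    rw [VectorMeasure.le_restrict_univ_iff_le, VectorMeasure.le_iff]
    intro S hS
    rw [hs S hS]
    exact norm_nonneg _
  refine isFiniteMeasure_of_le (s.toMeasureOfZeroLE Set.univ MeasurableSet.univ h0) ?_
  refine VectorMeasure.variation_le_of_forall_enorm_le fun S hS => ?_
  rw [SignedMeasure.toMeasureOfZeroLE_apply _ _ _ hS]
  rw [← ofReal_norm, ← hs S hS, ENNReal.ofReal]
  apply le_of_eq
  congr 1
  ext
  simp [hs S hS]

/-- The integral of a family of operators bounded below by a fixed one is bounded below. -/
theorem IsGeneralizedStateMeasure.apply_le_integral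
    {n : VectorMeasure Z (StrongDual ℂ (H →L[ℂ] H))} (hn : IsGeneralizedStateMeasure n)
    {G : Z → H →L[ℂ] H} (hG : n.Integrable G) {A : H →L[ℂ] H} (hA : ∀ z, (G z - A).IsPositive) :
    n Set.univ A ≤ n.integral G (evalPairing H) := by
  have := hn.isFiniteMeasure_variation
  have h1 : n Set.univ A = n.integral (fun _ => A) (evalPairing H) := by
    rw [VectorMeasure.integral_const, evalPairing_apply]
  rw [h1]
  -- Monotonicity of the integral reduces to positivity of each `n S`; the constant `A` is
  -- integrable because the variation is finite.
  refine setToFun_mono _ ?_ (integrable_const A) hG (Eventually.of_forall hA)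
  intro S hS _ B hB
  exact (hn S hS).2 B ((ContinuousLinearMap.nonneg_iff_isPositive B).1 hB)

end StateMeasures

/-! ## Equality of the variational problems -/

namespace QuasiClassicalForms

variable {H Z : Type*} [NormedAddCommGroup H] [InnerProductSpace ℂ H]
  {M : QuasiClassicalForms H Z}

theorem energyGQC_le_energyGQCPure : M.energyGQC ≤ M.energyGQCPure := by
  refine sInf_le_sInf ?_
  rintro _ ⟨ρ, z, e, hρ, h⟩
  exact ⟨ρ, z, e, hρ.1, h⟩

variable [CompleteSpace H]

/-- The form of this operator at `φ` is `⟨ψ|ℋ_z|ψ⟩ - E ‖ψ‖²` with `ψ = Rφ`, so the variational bound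
on unit vectors extends to all `φ` by homogeneity. This turns the energy bound into an operator
inequality that any positive functional respects. -/
theorem IsSandwich.sub_smul_isPositive {R G : H →L[ℂ] H} {z : Z} {E : ℝ} (hR : M.IsInvSqrt R)
    (hG : M.IsSandwich R z G) (hE : (E : EReal) ≤ M.energyQC) :
    (G - (E : ℂ) • (R ∘L R)).IsPositive := by
  have hinner : ∀ φ, inner ℂ φ ((G - (E : ℂ) • (R ∘L R)) φ)
      = ((M.energyForm z (R φ) - E * ‖R φ‖ ^ 2 : ℝ) : ℂ) := by
    intro φ
    have h1 : inner ℂ φ (R (R φ)) = ((‖R φ‖ ^ 2 : ℝ) : ℂ) := by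
      have h2 : inner ℂ (R φ) (R φ) = inner ℂ φ (R (R φ)) :=
        hR.1.isSelfAdjoint.isSymmetric φ (R φ)
      simp [← h2]
    simp only [sub_apply, smul_apply, ContinuousLinearMap.comp_apply, inner_sub_right,
      inner_smul_right, hG φ, h1]
    push_cast
    ring
  have hpos : ∀ φ, 0 ≤ M.energyForm z (R φ) - E * ‖R φ‖ ^ 2 := by
    intro φ
    -- `QuasiClassicalForms` imposes no quadratic structure on `energyForm`. Its value at zero and
    -- its homogeneity on the range of `R` are read off from the form of `G`.
    by_cases h0 : R φ = 0
    · have := hG 0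
      rw [map_zero, inner_zero_right] at this
      rw [h0, ← Complex.ofReal_eq_zero.1 this.symm]
      simp
    have hn : 0 < ‖R φ‖ := norm_pos_iff.2 h0
    set c : ℝ := ‖R φ‖⁻¹ with hc
    have h1 : M.energyForm z (R ((c : ℂ) • φ)) = c ^ 2 * M.energyForm z (R φ) := by
      have h2 := hG ((c : ℂ) • φ)
      rw [map_smul, inner_smul_left, inner_smul_right, hG φ, Complex.conj_ofReal] at h2
      have h3 : ((c ^ 2 * M.energyForm z (R φ) : ℝ) : ℂ)
          = ((M.energyForm z (R ((c : ℂ) • φ)) : ℝ) : ℂ) := by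
        rw [← h2]; push_cast; ring
      exact (Complex.ofReal_injective h3).symm
    have h2 : ‖R ((c : ℂ) • φ)‖ = 1 := by
      rw [map_smul, norm_smul, Complex.norm_real, Real.norm_of_nonneg (by positivity), hc,
        inv_mul_cancel₀ hn.ne']
    have h3 : (E : EReal) ≤ (M.energyForm z (R ((c : ℂ) • φ)) : ℝ) :=
      hE.trans (sInf_le ⟨R ((c : ℂ) • φ), z, h2, hR.2.1 ▸ Set.mem_range_self _, rfl⟩)
    rw [EReal.coe_le_coe_iff, h1, hc, inv_pow, inv_mul_eq_div, le_div_iff₀ (by positivity)] at h3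
    linarith
  rw [ContinuousLinearMap.isPositive_iff_complex]
  intro φ
  rw [← inner_conj_symm, hinner, Complex.conj_ofReal]
  exact ⟨rfl, hpos φ⟩

/-- Positivity of `ρ_𝒯` suffices here; membership in the weak-* closure plays no part in the lower
bound. -/
theorem energyQC_le_energyGQC : M.energyQC ≤ M.energyGQC := by
  refine le_sInf ?_
  rintro _ ⟨ρ, z, e, hρ, ⟨R, G, ρT, hR, hG, hρT, hρρT, he⟩, rfl⟩
  -- Comparing with real `E` strictly below the infimum covers infinite values as well.
  refine EReal.ge_of_forall_gt_iff_ge.1 fun E hE => ?_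
  have h1 := hρT.2 _ (hG.sub_smul_isPositive hR hE.le)
  have h2 : ρT (R ∘L R) = 1 := by
    have := hρρT 1
    rw [apply_one_eq_norm hρ.1.2, hρ.2, Complex.ofReal_one] at this
    rw [← this]
    rfl
  rw [map_sub, map_smul, he, h2, smul_eq_mul, mul_one, sub_nonneg] at h1
  exact_mod_cast h1

/-- For `ψ = Rφ`, self-adjointness gives `⟨φ|R B R|φ⟩ = ⟨ψ|B|ψ⟩`, so the vector functional of `φ`
serves as `ρ_𝒯` for the pure state of `ψ`. -/
theorem energyGQCPure_le_energyQC
    (hM : ∃ R, M.IsInvSqrt R ∧ ∀ z, ∃ G, M.IsSandwich R z G) :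
    M.energyGQCPure ≤ M.energyQC := by
  obtain ⟨R, hR, hG⟩ := hM
  refine le_sInf ?_
  rintro _ ⟨ψ, z, hψ, hψM, rfl⟩
  obtain ⟨φ, rfl⟩ := hR.2.1.symm ▸ hψM
  obtain ⟨G, hG⟩ := hG z
  refine sInf_le ⟨vectorFunctional (R φ), z, _, vectorFunctional_mem_pureGeneralizedStates hψ,
    ⟨R, G, vectorFunctional φ, hR, hG, vectorFunctional_mem_cone φ, fun B => ?_, hG φ⟩, rfl⟩
  exact (hR.1.isSelfAdjoint.isSymmetric φ (B (R φ))).symm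

variable [MeasurableSpace Z]

/-- `E R²` is a lower bound for `G z` independent of `z`, and its integral is `E` times `n_𝒯(Z)[R²]
= n(Z)[1] = 1`. -/
theorem energyQC_le_energyGSVM : M.energyQC ≤ M.energyGSVM := by
  refine le_sInf ?_
  rintro _ ⟨n, e, hn, hn1, ⟨R, G, nT, hR, hG, hnT, hnnT, hint, he⟩, rfl⟩
  refine EReal.ge_of_forall_gt_iff_ge.1 fun E hE => ?_
  have h1 := hnT.apply_le_integral hint fun z => (hG z).sub_smul_isPositive hR hE.le
  have h2 : nT Set.univ (R ∘L R) = 1 := by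
    have := hnnT Set.univ MeasurableSet.univ 1
    rw [apply_one_eq_norm (hn _ MeasurableSet.univ).2, hn1, Complex.ofReal_one] at this
    rw [← this]
    rfl
  rw [map_smul, he, h2, smul_eq_mul, mul_one] at h1
  exact_mod_cast h1

theorem energyGSVM_le_energyQC [MeasurableSingletonClass Z]
    (hM : ∃ R, M.IsInvSqrt R ∧ ∀ z, ∃ G, M.IsSandwich R z G) :
    M.energyGSVM ≤ M.energyQC := by
  obtain ⟨R, hR, hG⟩ := hM
  choose G hG using hG
  refine le_sInf ?_
  rintro _ ⟨ψ, z, hψ, hψM, rfl⟩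
  obtain ⟨φ, rfl⟩ := hR.2.1.symm ▸ hψM
  refine sInf_le ⟨VectorMeasure.dirac z (vectorFunctional (R φ)), _,
    isGeneralizedStateMeasure_dirac (vectorFunctional_mem_cone _) zero_mem_generalizedStateCone z,
    ?_, ⟨R, G, VectorMeasure.dirac z (vectorFunctional φ), hR, hG,
      isGeneralizedStateMeasure_dirac (vectorFunctional_mem_cone _)
        zero_mem_generalizedStateCone z, fun S hS B => ?_, ?_, ?_⟩, rfl⟩
  · rw [VectorMeasure.dirac_apply_of_mem MeasurableSet.univ (Set.mem_univ z),
      (vectorFunctional_mem_generalizedStates hψ).2]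
  · by_cases hz : z ∈ S
    · rw [VectorMeasure.dirac_apply_of_mem hS hz, VectorMeasure.dirac_apply_of_mem hS hz]
      exact (hR.1.isSelfAdjoint.isSymmetric φ (B (R φ))).symm
    · rw [VectorMeasure.dirac_apply_of_notMem hz, VectorMeasure.dirac_apply_of_notMem hz]
      rfl
  -- The variation is a finite multiple of a point mass. Singletons are measurable, so no regularity
  -- of `z ↦ G z` is needed.
  · rw [VectorMeasure.Integrable, VectorMeasure.variation_dirac]
    exact (integrable_dirac (by simp)).smul_measure (by simp)
  · rw [VectorMeasure.integral_dirac, evalPairing_apply]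
    exact hG z φ

/-- The three variational problems have the same value as soon as `𝒯^{-1/2}` and all the operators
`𝒯^{-1/2} ℋ_z 𝒯^{-1/2}` exist. -/
theorem energies_eq [MeasurableSingletonClass Z]
    (hM : ∃ R, M.IsInvSqrt R ∧ ∀ z, ∃ G, M.IsSandwich R z G) :
    M.energyQC = M.energyGQC ∧ M.energyGQC = M.energyGSVM ∧ M.energyGQCPure = M.energyQC := by
  have h1 : M.energyQC = M.energyGQC := le_antisymm energyQC_le_energyGQC
    (energyGQC_le_energyGQCPure.trans (energyGQCPure_le_energyQC hM))
  refine ⟨h1, h1 ▸ le_antisymm energyQC_le_energyGSVM (energyGSVM_le_energyQC hM), ?_⟩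
  exact le_antisymm (energyGQCPure_le_energyQC hM) (h1.le.trans energyGQC_le_energyGQCPure)

end QuasiClassicalForms

/-! ## The inverse square root of the operator of a closed form -/

section InverseSquareRoot

variable {H Q : Type*} [NormedAddCommGroup H] [InnerProductSpace ℂ H] [CompleteSpace H]
  [NormedAddCommGroup Q] [InnerProductSpace ℂ Q] [CompleteSpace Q]

theorem denseRange_of_orthogonal_range {E K : Type*} [NormedAddCommGroup E] [InnerProductSpace ℂ E]
    [NormedAddCommGroup K] [InnerProductSpace ℂ K] [CompleteSpace K] (T : E →L[ℂ] K)
    (hT : ∀ y, (∀ x, inner ℂ (T x) y = 0) → y = 0) : DenseRange T := by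
  have h : (LinearMap.range T.toLinearMap).topologicalClosure = ⊤ := by
    rw [Submodule.topologicalClosure_eq_top_iff, Submodule.eq_bot_iff]
    intro y hy
    exact hT y fun x => (Submodule.mem_orthogonal _ _).1 hy _ ⟨x, rfl⟩
  have := Submodule.dense_iff_topologicalClosure_eq_top.2 h
  rwa [LinearMap.coe_range] at this

/-- If `J` is a bounded injection with dense range of the form domain `Q` into `H`, the inverse square
root `R` of the operator of the form is a positive operator that factors through an isometry of `H`
onto `Q`. -/
theorem exists_isPositive_eq_comp_isometry (J : Q →L[ℂ] H) (hJ : Function.Injective J)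
    (hJd : ∀ y, (∀ q, inner ℂ (J q) y = 0) → y = 0) :
    ∃ (R : H →L[ℂ] H) (U : H →L[ℂ] Q), R.IsPositive ∧ (∀ x, ‖U x‖ = ‖x‖) ∧
      Function.Surjective U ∧ R = J ∘L U := by
  -- `J J*` is the inverse of the operator of the form. The map `U` below is the partial isometry in
  -- the polar decomposition `J* = U R`; it is defined on the dense range of `R`, where `‖R x‖ = ‖J*
  -- x‖`.
  set A : H →L[ℂ] H := J ∘L J.adjoint with hA
  have hApos : 0 ≤ A := by
    rw [ContinuousLinearMap.nonneg_iff_isPositive]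
    exact ContinuousLinearMap.isPositive_self_comp_adjoint J
  set R : H →L[ℂ] H := CFC.sqrt A with hRdef
  have hRpos : R.IsPositive :=
    (ContinuousLinearMap.nonneg_iff_isPositive R).1 (CFC.sqrt_nonneg A)
  have hRR : R * R = A := CFC.sqrt_mul_sqrt_self A hApos
  have hRs : R.adjoint = R := hRpos.isSelfAdjoint.adjoint_eq
  have hnorm : ∀ x, ‖R x‖ = ‖J.adjoint x‖ := by
    intro x
    rw [← sq_eq_sq₀ (norm_nonneg _) (norm_nonneg _), ← inner_self_eq_norm_sq (𝕜 := ℂ),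
      ← inner_self_eq_norm_sq (𝕜 := ℂ), ContinuousLinearMap.adjoint_inner_right,
      ← ContinuousLinearMap.adjoint_inner_right, hRs]
    rw [show R (R x) = (R * R) x from rfl, hRR, hA, inner_re_symm]
    rfl
  have hJ' : ∀ x, J.adjoint x = 0 → x = 0 := by
    intro x hx
    refine hJd x fun q => ?_
    rw [← ContinuousLinearMap.adjoint_inner_right, hx, inner_zero_right]
  have hRd : DenseRange R := by
    refine denseRange_of_orthogonal_range R fun y hy => ?_
    refine hJ' y (norm_eq_zero.1 ?_)
    rw [← hnorm, norm_eq_zero, ← inner_self_eq_zero (𝕜 := ℂ),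
      ← ContinuousLinearMap.adjoint_inner_left, hRs]
    exact hy (R y)
  set U : H →L[ℂ] Q := J.adjoint.toLinearMap.extendOfNorm R.toLinearMap with hU
  have hUR : ∀ x, U (R x) = J.adjoint x :=
    LinearMap.extendOfNorm_eq (f := J.adjoint.toLinearMap) (e := R.toLinearMap) hRd
      ⟨1, fun x => by simp [hnorm]⟩
  have hUnorm : ∀ x, ‖U x‖ = ‖x‖ := by
    intro x
    refine hRd.induction_on (p := fun x => ‖U x‖ = ‖x‖) x
      (isClosed_eq (by fun_prop) (by fun_prop)) fun y => ?_
    rw [hUR, hnorm]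
  have hUiso : Isometry U := AddMonoidHomClass.isometry_of_norm U hUnorm
  have hUd : DenseRange U := by
    refine denseRange_of_orthogonal_range U fun y hy => ?_
    refine hJ ?_
    rw [map_zero, ← inner_self_eq_zero (𝕜 := ℂ), ← ContinuousLinearMap.adjoint_inner_left, ← hUR]
    exact hy _
  -- An isometry has closed range, and injectivity of `J` makes this range dense.
  have hUs : Function.Surjective U := by
    rw [← Set.range_eq_univ, ← hUiso.isClosedEmbedding.isClosed_range.closure_eq]
    exact hUd.closure_range
  refine ⟨R, U, hRpos, hUnorm, hUs, ?_⟩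
  have hUU : U.adjoint ∘L U = 1 :=
    (ContinuousLinearMap.norm_map_iff_adjoint_comp_self U).1 hUnorm
  have h1 : U ∘L R = J.adjoint := by ext x; exact hUR x
  -- The adjoint of `U R = J*`. Composing with `U` on the right and using `U* U = 1` gives `R = J
  -- U`.
  have h2 : R ∘L U.adjoint = J := by
    have := congrArg ContinuousLinearMap.adjoint h1
    rwa [ContinuousLinearMap.adjoint_comp, ContinuousLinearMap.adjoint_adjoint, hRs] at this
  rw [← h2, ContinuousLinearMap.comp_assoc, hUU]
  rfl

end InverseSquareRoot

/-! ## Multiplication operators on `L²` -/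

section MultiplicationOperators

variable {α : Type*} [MeasurableSpace α] {μ : Measure α}

theorem Lp_norm_sq_eq_integral (ψ : Lp ℂ 2 μ) : ‖ψ‖ ^ 2 = ∫ x, ‖ψ x‖ ^ 2 ∂μ := by
  have h : ((‖ψ‖ ^ 2 : ℝ) : ℂ) = ((∫ x, ‖ψ x‖ ^ 2 ∂μ : ℝ) : ℂ) := by
    rw [← integral_complex_ofReal, Complex.ofReal_pow]
    have := inner_self_eq_norm_sq_to_K (𝕜 := ℂ) ψ
    rw [RCLike.ofReal_eq_complex_ofReal] at this
    rw [← this, L2.inner_def]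
    simp [inner_self_eq_norm_sq_to_K]
  exact Complex.ofReal_injective h

/-- Multiplication by an essentially bounded real function. -/
noncomputable def mulOp (f : α → ℝ) (hf : MemLp f ⊤ μ) : Lp ℂ 2 μ →L[ℂ] Lp ℂ 2 μ :=
  (ContinuousLinearMap.mul ℂ ℂ).holderL μ ⊤ 2 2 (hf.ofReal (K := ℂ)).toLp

theorem coeFn_mulOp {f : α → ℝ} (hf : MemLp f ⊤ μ) (ψ : Lp ℂ 2 μ) :
    mulOp f hf ψ =ᵐ[μ] fun x => (f x : ℂ) * ψ x := by
  have h := (ContinuousLinearMap.mul ℂ ℂ).coeFn_holder (r := 2) (hf.ofReal (K := ℂ)).toLp ψ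
  filter_upwards [h, (hf.ofReal (K := ℂ)).coeFn_toLp] with x h1 h2
  exact h1.trans (by rw [h2]; rfl)

theorem re_inner_mulOp {f : α → ℝ} (hf : MemLp f ⊤ μ) (ψ g : Lp ℂ 2 μ) :
    (inner ℂ ψ (mulOp f hf g)).re = ∫ x, f x * (conj (ψ x) * g x).re ∂μ := by
  rw [L2.inner_def]
  have h := integral_re (L2.integrable_inner (𝕜 := ℂ) ψ (mulOp f hf g))
  refine h.symm.trans (integral_congr_ae ?_)
  filter_upwards [coeFn_mulOp hf g] with x hx
  rw [hx]
  simp only [RCLike.inner_apply, RCLike.re_to_complex]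
  rw [← Complex.re_ofReal_mul]
  congr 1
  ring

theorem re_inner_mulOp_self {f : α → ℝ} (hf : MemLp f ⊤ μ) (ψ : Lp ℂ 2 μ) :
    (inner ℂ ψ (mulOp f hf ψ)).re = ∫ x, f x * ‖ψ x‖ ^ 2 ∂μ := by
  rw [re_inner_mulOp]
  congr with x
  rw [← Complex.normSq_eq_norm_sq, ← Complex.normSq_eq_conj_mul_self, Complex.ofReal_re]

end MultiplicationOperators

/-! ## Weak derivatives -/

section WeakDerivatives

variable {N d : ℕ}

/-- A continuous real function with compact support, as an element of `L²`. -/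
noncomputable def testVec (f : Config N d → ℝ) (hf : Continuous f) (hc : HasCompactSupport f) :
    ParticleSpace N d :=
  ((hf.memLp_of_hasCompactSupport (p := 2) (μ := volume) hc).ofReal (K := ℂ)).toLp

theorem coeFn_testVec {f : Config N d → ℝ} (hf : Continuous f) (hc : HasCompactSupport f) :
    testVec f hf hc =ᵐ[volume] fun X => (f X : ℂ) :=
  MemLp.coeFn_toLp _

theorem inner_testVec {f : Config N d → ℝ} (hf : Continuous f) (hc : HasCompactSupport f)
    (ψ : ParticleSpace N d) : inner ℂ (testVec f hf hc) ψ = ∫ X, f X • ψ X := by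
  rw [L2.inner_def]
  refine integral_congr_ae ?_
  filter_upwards [coeFn_testVec hf hc] with X hX
  rw [hX]
  simp [mul_comm]

theorem continuous_fderiv_coord {f : Config N d → ℝ} (hf : ContDiff ℝ (⊤ : ℕ∞) f)
    (v : Config N d) : Continuous fun X => fderiv ℝ f X v :=
  (hf.continuous_fderiv (by simp)).clm_apply continuous_const

theorem hasCompactSupport_fderiv_coord {f : Config N d → ℝ} (hc : HasCompactSupport f)
    (v : Config N d) : HasCompactSupport fun X => fderiv ℝ f X v :=
  hc.fderiv_apply ℝ v

/-- In this form the relation is a family of continuous conditions on the pair `(ψ, g)`, from which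
linearity and closedness of the weak derivative follow. -/
theorem hasWeakPartial_iff_inner {ψ g : ParticleSpace N d} {j : Fin N} {l : Fin d} :
    HasWeakPartial ψ j l g ↔ ∀ (f : Config N d → ℝ) (hf : ContDiff ℝ (⊤ : ℕ∞) f)
      (hc : HasCompactSupport f),
      inner ℂ (testVec _ (continuous_fderiv_coord hf (coordVec j l))
        (hasCompactSupport_fderiv_coord hc (coordVec j l))) ψ
      = -inner ℂ (testVec f hf.continuous hc) g := by
  simp only [inner_testVec, HasWeakPartial]

/-- The fundamental lemma of the calculus of variations. It gives both uniqueness of weak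
derivatives and density of the form domain. -/
theorem eq_zero_of_inner_testVec {ψ : ParticleSpace N d}
    (h : ∀ (f : Config N d → ℝ) (hf : ContDiff ℝ (⊤ : ℕ∞) f) (hc : HasCompactSupport f),
      inner ℂ (testVec f hf.continuous hc) ψ = 0) : ψ = 0 := by
  rw [Lp.eq_zero_iff_ae_eq_zero]
  refine ae_eq_zero_of_integral_contDiff_smul_eq_zero
    ((Lp.memLp ψ).locallyIntegrable one_le_two) fun f hf hc => ?_
  rw [← inner_testVec hf.continuous hc]
  exact h f hf hc

namespace HasWeakPartial

variable {ψ ψ' g g' : ParticleSpace N d} {j : Fin N} {l : Fin d}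

theorem unique (h : HasWeakPartial ψ j l g) (h' : HasWeakPartial ψ j l g') : g = g' := by
  rw [← sub_eq_zero]
  refine eq_zero_of_inner_testVec fun f hf hc => ?_
  rw [inner_sub_right, sub_eq_zero, ← neg_inj, ← hasWeakPartial_iff_inner.1 h f hf hc,
    ← hasWeakPartial_iff_inner.1 h' f hf hc]

theorem weakPartial_eq (h : HasWeakPartial ψ j l g) : weakPartial ψ j l = g := by
  have hex : ∃ g, HasWeakPartial ψ j l g := ⟨g, h⟩
  rw [weakPartial, dif_pos hex]
  exact hex.choose_spec.unique h

theorem zero : HasWeakPartial (0 : ParticleSpace N d) j l 0 := by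
  rw [hasWeakPartial_iff_inner]
  intro f hf hc
  simp

theorem add (h : HasWeakPartial ψ j l g) (h' : HasWeakPartial ψ' j l g') :
    HasWeakPartial (ψ + ψ') j l (g + g') := by
  rw [hasWeakPartial_iff_inner] at *
  intro f hf hc
  rw [inner_add_right, inner_add_right, h f hf hc, h' f hf hc]
  ring

theorem smul (a : ℂ) (h : HasWeakPartial ψ j l g) : HasWeakPartial (a • ψ) j l (a • g) := by
  rw [hasWeakPartial_iff_inner] at *
  intro f hf hc
  rw [inner_smul_right, inner_smul_right, h f hf hc]
  ring

end HasWeakPartial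

/-- A test function is weakly differentiable with its classical derivative. -/
theorem hasWeakPartial_testVec {f : Config N d → ℝ} (hf : ContDiff ℝ (⊤ : ℕ∞) f)
    (hc : HasCompactSupport f) (j : Fin N) (l : Fin d) :
    HasWeakPartial (testVec f hf.continuous hc) j l
      (testVec _ (continuous_fderiv_coord hf (coordVec j l))
        (hasCompactSupport_fderiv_coord hc (coordVec j l))) := by
  intro φ hφ hφc
  set v : Config N d := coordVec j l
  have hcd := continuous_fderiv_coord hf v
  have hcdφ := continuous_fderiv_coord hφ v
  have h1 : ∫ X, fderiv ℝ φ X v • testVec f hf.continuous hc X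
      = ((∫ X, f X * fderiv ℝ φ X v : ℝ) : ℂ) := by
    rw [← integral_complex_ofReal]
    refine integral_congr_ae ?_
    filter_upwards [coeFn_testVec hf.continuous hc] with X hX
    rw [hX]
    simp [mul_comm]
  have h2 : ∫ X, φ X • testVec _ hcd (hasCompactSupport_fderiv_coord hc v) X
      = ((∫ X, fderiv ℝ f X v * φ X : ℝ) : ℂ) := by
    rw [← integral_complex_ofReal]
    refine integral_congr_ae ?_
    filter_upwards [coeFn_testVec hcd (hasCompactSupport_fderiv_coord hc v)] with X hX
    rw [hX]
    simp [mul_comm]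
  rw [h1, h2, ← Complex.ofReal_neg]
  congr 1
  -- Integration by parts; the three products are continuous with compact support, hence integrable.
  refine integral_mul_fderiv_eq_neg_fderiv_mul_of_integrable ?_ ?_ ?_
    (fun X _ => (hf.differentiable (by simp)) X) (fun X _ => (hφ.differentiable (by simp)) X)
  · exact (hcd.mul hφ.continuous).integrable_of_hasCompactSupport hφc.mul_left
  · exact (hf.continuous.mul hcdφ).integrable_of_hasCompactSupport hc.mul_right
  · exact (hf.continuous.mul hφ.continuous).integrable_of_hasCompactSupport hc.mul_right

/-- Local integrability of `W` makes `W f²` integrable, so the form domain contains all test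
functions and is dense. -/
theorem testVec_mem_freeFormDomain {W : Config N d → ℝ} (hW : LocallyIntegrable W volume)
    {f : Config N d → ℝ} (hf : ContDiff ℝ (⊤ : ℕ∞) f) (hc : HasCompactSupport f) :
    testVec f hf.continuous hc ∈ freeFormDomain W := by
  refine ⟨fun j l => ⟨_, hasWeakPartial_testVec hf hc j l⟩, ?_⟩
  have h := hW.integrable_smul_right_of_hasCompactSupport (g := fun X => f X ^ 2)
    (hf.continuous.pow 2) (hc.comp_left (g := fun t : ℝ => t ^ 2) (by simp))
  refine h.congr ?_
  filter_upwards [coeFn_testVec hf.continuous hc] with X hX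
  rw [hX]
  simp

end WeakDerivatives

/-! ## The form domain of the free operator as a Hilbert space -/

section FormDomain

variable {N d : ℕ}

theorem memLp_top_of_abs_le {α : Type*} [MeasurableSpace α] {μ : Measure α} {f : α → ℝ}
    (hf : AEStronglyMeasurable f μ) (C : ℝ) (hC : ∀ x, |f x| ≤ C) : MemLp f ⊤ μ :=
  memLp_top_of_bound hf C (Eventually.of_forall hC)

/-- Multiplication by `√W` is unbounded. Dividing `y = √W ψ` by `1 + √W` puts bounded multipliers on
both sides, which makes the relation visibly closed. -/
theorem memLp_top_sqrt_div {W : Config N d → ℝ} (hW : AEStronglyMeasurable W volume) :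
    MemLp (fun X => √(W X) / (1 + √(W X))) ⊤ volume := by
  refine memLp_top_of_abs_le (AEMeasurable.aestronglyMeasurable ?_) 1 fun X => ?_
  · have := hW.aemeasurable.sqrt
    fun_prop
  · have := Real.sqrt_nonneg (W X)
    rw [abs_of_nonneg (by positivity), div_le_one (by positivity)]
    linarith

theorem memLp_top_inv_one_add_sqrt {W : Config N d → ℝ} (hW : AEStronglyMeasurable W volume) :
    MemLp (fun X => (1 + √(W X))⁻¹) ⊤ volume := by
  refine memLp_top_of_abs_le (AEMeasurable.aestronglyMeasurable ?_) 1 fun X => ?_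
  · have := hW.aemeasurable.sqrt
    fun_prop
  · have := Real.sqrt_nonneg (W X)
    rw [abs_of_nonneg (by positivity)]
    exact inv_le_one_of_one_le₀ (by linarith)

/-- The relation `y = √W ψ`, in terms of bounded multiplication operators. -/
theorem mulOp_eq_mulOp_iff {W : Config N d → ℝ} (hW : AEStronglyMeasurable W volume)
    {ψ y : ParticleSpace N d} :
    mulOp _ (memLp_top_sqrt_div hW) ψ = mulOp _ (memLp_top_inv_one_add_sqrt hW) y ↔
      y =ᵐ[volume] fun X => (√(W X) : ℂ) * ψ X := by
  have key : ∀ X, ((√(W X) / (1 + √(W X)) : ℝ) : ℂ) * ψ X = (((1 + √(W X))⁻¹ : ℝ) : ℂ) * y X ↔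
      y X = (√(W X) : ℂ) * ψ X := by
    intro X
    have h : ((1 + √(W X) : ℝ) : ℂ) ≠ 0 := by
      have := Real.sqrt_nonneg (W X)
      exact_mod_cast (by positivity : (1 + √(W X)) ≠ 0)
    rw [div_eq_inv_mul, Complex.ofReal_mul, Complex.ofReal_inv, mul_assoc,
      mul_right_inj' (inv_ne_zero h), eq_comm]
  rw [Lp.ext_iff]
  have h1 := coeFn_mulOp (memLp_top_sqrt_div hW) ψ
  have h2 := coeFn_mulOp (memLp_top_inv_one_add_sqrt hW) y
  constructor <;> intro h
  · filter_upwards [h, h1, h2] with X h h1 h2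
    rw [h1, h2] at h
    exact (key X).1 h
  · filter_upwards [h, h1, h2] with X h h1 h2
    rw [h1, h2]
    exact (key X).2 h

/-- The space of all `(ψ, √W ψ, (√cⱼ ∂_{j,l} ψ)_{j,l})`, whose norm is the form norm of `ψ`. -/
abbrev FormSpace (N d : ℕ) : Type :=
  PiLp 2 fun _ : Option (Option (Fin N × Fin d)) => ParticleSpace N d

/-- The coordinates of `FormSpace`. -/
noncomputable def formCoord (i : Option (Option (Fin N × Fin d))) :
    FormSpace N d →L[ℂ] ParticleSpace N d :=
  PiLp.proj 2 (fun _ : Option (Option (Fin N × Fin d)) => ParticleSpace N d) i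

/-- The graph of `ψ ↦ (√W ψ, (√cⱼ ∂_{j,l} ψ)_{j,l})`. -/
noncomputable def formGraph (c : Fin N → ℝ) {W : Config N d → ℝ}
    (hW : AEStronglyMeasurable W volume) : Submodule ℂ (FormSpace N d) where
  -- Attaching `√cⱼ` to `ψ` lets the last coordinates carry the weighted derivatives, so the Hilbert
  -- norm is the form norm.
  carrier := {q | (∀ j l, HasWeakPartial (((√(c j) : ℝ) : ℂ) • formCoord none q) j l
      (formCoord (some (some (j, l))) q)) ∧
    mulOp _ (memLp_top_sqrt_div hW) (formCoord none q)
      = mulOp _ (memLp_top_inv_one_add_sqrt hW) (formCoord (some none) q)}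
  add_mem' := by
    rintro p q ⟨hp, hp'⟩ ⟨hq, hq'⟩
    refine ⟨fun j l => ?_, ?_⟩
    · rw [map_add, map_add, smul_add]
      exact (hp j l).add (hq j l)
    · rw [map_add, map_add, map_add, map_add, hp', hq']
  zero_mem' := by
    refine ⟨fun j l => ?_, ?_⟩
    · rw [map_zero, map_zero, smul_zero]
      exact HasWeakPartial.zero
    · simp
  smul_mem' := by
    rintro a q ⟨hq, hq'⟩
    refine ⟨fun j l => ?_, ?_⟩
    · rw [map_smul, map_smul, smul_comm]
      exact (hq j l).smul a
    · rw [map_smul, map_smul, map_smul, map_smul, hq']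

/-- Each test function imposes a closed condition, and the potential is expressed through bounded
operators. This amounts to closedness of the form: the form domain is complete. -/
theorem isClosed_formGraph (c : Fin N → ℝ) {W : Config N d → ℝ}
    (hW : AEStronglyMeasurable W volume) : IsClosed (formGraph c hW : Set (FormSpace N d)) := by
  have h : (formGraph c hW : Set (FormSpace N d)) =
      {q | (∀ j l, HasWeakPartial (((√(c j) : ℝ) : ℂ) • formCoord none q) j l
        (formCoord (some (some (j, l))) q)) ∧
      mulOp _ (memLp_top_sqrt_div hW) (formCoord none q)
        = mulOp _ (memLp_top_inv_one_add_sqrt hW) (formCoord (some none) q)} := rfl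
  have h1 : IsClosed {q : FormSpace N d | ∀ j l,
      HasWeakPartial (((√(c j) : ℝ) : ℂ) • formCoord none q) j l
        (formCoord (some (some (j, l))) q)} := by
    simp only [hasWeakPartial_iff_inner, Set.ofPred_forall]
    refine isClosed_iInter fun j => isClosed_iInter fun l => isClosed_iInter fun f =>
      isClosed_iInter fun hf => isClosed_iInter fun hc => isClosed_eq ?_ ?_
    · exact continuous_const.inner (by fun_prop)
    · exact (continuous_const.inner (by fun_prop)).neg
  rw [h]
  exact h1.inter (isClosed_eq (by fun_prop) (by fun_prop))

theorem norm_sq_formSpace (q : FormSpace N d) :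
    ‖q‖ ^ 2 = ‖formCoord none q‖ ^ 2 + (‖formCoord (some none) q‖ ^ 2 +
      ∑ j, ∑ l, ‖formCoord (some (some (j, l))) q‖ ^ 2) := by
  rw [PiLp.norm_sq_eq_of_L2, Fintype.sum_option, Fintype.sum_option, Fintype.sum_prod_type]
  rfl

/-- `∫ W |ψ|² = ‖√W ψ‖²`. -/
theorem integral_potential_eq_norm_sq {W : Config N d → ℝ} (hW0 : ∀ᵐ X, 0 ≤ W X)
    {ψ y : ParticleSpace N d} (hy : y =ᵐ[volume] fun X => (√(W X) : ℂ) * ψ X) :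
    ∫ X, W X * ‖ψ X‖ ^ 2 = ‖y‖ ^ 2 := by
  rw [Lp_norm_sq_eq_integral]
  refine integral_congr_ae ?_
  filter_upwards [hy, hW0] with X h h0
  rw [h, norm_mul, mul_pow, Complex.norm_real, Real.norm_of_nonneg (Real.sqrt_nonneg _),
    Real.sq_sqrt h0]

theorem integrable_potential {W : Config N d → ℝ} (hW0 : ∀ᵐ X, 0 ≤ W X)
    {ψ y : ParticleSpace N d} (hy : y =ᵐ[volume] fun X => (√(W X) : ℂ) * ψ X) :
    Integrable fun X => W X * ‖ψ X‖ ^ 2 := by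
  refine ((memLp_two_iff_integrable_sq_norm (Lp.memLp y).1).1 (Lp.memLp y)).congr ?_
  filter_upwards [hy, hW0] with X h h0
  rw [h, norm_mul, mul_pow, Complex.norm_real, Real.norm_of_nonneg (Real.sqrt_nonneg _),
    Real.sq_sqrt h0]

theorem exists_sqrt_potential_mul {W : Config N d → ℝ} (hW : AEStronglyMeasurable W volume)
    (hW0 : ∀ᵐ X, 0 ≤ W X) {ψ : ParticleSpace N d} (hψ : Integrable fun X => W X * ‖ψ X‖ ^ 2) :
    ∃ y : ParticleSpace N d, y =ᵐ[volume] fun X => (√(W X) : ℂ) * ψ X := by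
  have hm : AEStronglyMeasurable (fun X => (√(W X) : ℂ) * ψ X) volume := by
    refine AEStronglyMeasurable.mul ?_ (Lp.memLp ψ).1
    exact (Complex.continuous_ofReal.comp Real.continuous_sqrt).comp_aestronglyMeasurable hW
  have hL : MemLp (fun X => (√(W X) : ℂ) * ψ X) 2 volume := by
    rw [memLp_two_iff_integrable_sq_norm hm]
    refine hψ.congr ?_
    filter_upwards [hW0] with X h0
    rw [norm_mul, mul_pow, Complex.norm_real, Real.norm_of_nonneg (Real.sqrt_nonneg _),
      Real.sq_sqrt h0]
  exact ⟨hL.toLp, hL.coeFn_toLp⟩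

section Graph

variable {c : Fin N → ℝ} {W : Config N d → ℝ}

theorem formGraph_sqrt_potential {hW : AEStronglyMeasurable W volume} {q : FormSpace N d}
    (hq : q ∈ formGraph c hW) :
    formCoord (some none) q =ᵐ[volume] fun X => (√(W X) : ℂ) * formCoord none q X :=
  (mulOp_eq_mulOp_iff hW).1 hq.2

theorem sqrt_coeff_ne_zero (hc : ∀ j, 0 < c j) (j : Fin N) : ((√(c j) : ℝ) : ℂ) ≠ 0 :=
  Complex.ofReal_ne_zero.2 (Real.sqrt_pos.2 (hc j)).ne'

theorem formGraph_hasWeakPartial (hc : ∀ j, 0 < c j) {hW : AEStronglyMeasurable W volume}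
    {q : FormSpace N d} (hq : q ∈ formGraph c hW) (j : Fin N) (l : Fin d) :
    HasWeakPartial (formCoord none q) j l
      (((√(c j) : ℝ) : ℂ)⁻¹ • formCoord (some (some (j, l))) q) := by
  have h := (hq.1 j l).smul ((√(c j) : ℝ) : ℂ)⁻¹
  rwa [inv_smul_smul₀ (sqrt_coeff_ne_zero hc j)] at h

theorem formGraph_mem_freeFormDomain (hc : ∀ j, 0 < c j) (hW0 : ∀ᵐ X, 0 ≤ W X)
    {hW : AEStronglyMeasurable W volume} {q : FormSpace N d} (hq : q ∈ formGraph c hW) :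
    formCoord none q ∈ freeFormDomain W :=
  ⟨fun j l => ⟨_, formGraph_hasWeakPartial hc hq j l⟩,
    integrable_potential hW0 (formGraph_sqrt_potential hq)⟩

theorem exists_mem_formGraph (c : Fin N → ℝ) (hW0 : ∀ᵐ X, 0 ≤ W X)
    (hW : AEStronglyMeasurable W volume) {ψ : ParticleSpace N d} (hψ : ψ ∈ freeFormDomain W) :
    ∃ q ∈ formGraph c hW, formCoord none q = ψ := by
  choose g hg using hψ.1
  obtain ⟨y, hy⟩ := exists_sqrt_potential_mul hW hW0 hψ.2
  let q : FormSpace N d := WithLp.toLp 2 fun i => match i with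
    | none => ψ
    | some none => y
    | some (some (j, l)) => ((√(c j) : ℝ) : ℂ) • g j l
  exact ⟨q, ⟨fun j l => (hg j l).smul _, (mulOp_eq_mulOp_iff hW).2 hy⟩, rfl⟩

/-- The form norm of an element of the graph. -/
theorem freeFormOf_formCoord (hc : ∀ j, 0 < c j) (hW0 : ∀ᵐ X, 0 ≤ W X)
    {hW : AEStronglyMeasurable W volume} {q : FormSpace N d} (hq : q ∈ formGraph c hW) :
    freeFormOf c W (formCoord none q) + ‖formCoord none q‖ ^ 2 = ‖q‖ ^ 2 := by
  have h : ∀ j l, c j * ‖weakPartial (formCoord none q) j l‖ ^ 2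
      = ‖formCoord (some (some (j, l))) q‖ ^ 2 := by
    intro j l
    rw [(formGraph_hasWeakPartial hc hq j l).weakPartial_eq, norm_smul, norm_inv,
      Complex.norm_real, Real.norm_of_nonneg (Real.sqrt_nonneg _), mul_pow, inv_pow,
      Real.sq_sqrt (hc j).le, mul_inv_cancel_left₀ (hc j).ne']
  rw [norm_sq_formSpace, freeFormOf,
    integral_potential_eq_norm_sq hW0 (formGraph_sqrt_potential hq)]
  simp only [Finset.mul_sum, h]
  ring

end Graph

/-- The operator `R = (𝒦₀ + 1)^{-1/2}`, together with the bounded operators `∂_{j,l} R` and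
`√W R`. -/
theorem exists_inverse_sqrt_free {c : Fin N → ℝ} (hc : ∀ j, 0 < c j) {W : Config N d → ℝ}
    (hW : LocallyIntegrable W volume) (hW0 : ∀ᵐ X, 0 ≤ W X) :
    ∃ (R : ParticleSpace N d →L[ℂ] ParticleSpace N d)
      (D : Fin N → Fin d → ParticleSpace N d →L[ℂ] ParticleSpace N d)
      (Y : ParticleSpace N d →L[ℂ] ParticleSpace N d),
      R.IsPositive ∧ Set.range R = freeFormDomain W ∧
      (∀ φ, freeFormOf c W (R φ) + ‖R φ‖ ^ 2 = ‖φ‖ ^ 2) ∧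
      (∀ φ j l, weakPartial (R φ) j l = D j l φ) ∧
      ∀ φ, ∫ X, W X * ‖R φ X‖ ^ 2 = ‖Y φ‖ ^ 2 := by
  have hWm := hW.aestronglyMeasurable
  let Q := formGraph c hWm
  have : CompleteSpace Q := (isClosed_formGraph c hWm).completeSpace_coe
  let J : Q →L[ℂ] ParticleSpace N d := formCoord none ∘L Q.subtypeL
  -- The `ψ` coordinate determines the others: `√W · 0 = 0`, and the weak derivative of zero is zero
  -- by uniqueness.
  have hJ : Function.Injective J := by
    refine (injective_iff_map_eq_zero J).2 fun q hq => ?_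
    have hq0 : formCoord none (q : FormSpace N d) = 0 := hq
    have h1 : formCoord (some none) (q : FormSpace N d) = 0 := by
      rw [Lp.eq_zero_iff_ae_eq_zero]
      filter_upwards [formGraph_sqrt_potential q.2, Lp.eq_zero_iff_ae_eq_zero.1 hq0] with X h h'
      rw [h, h']
      simp
    have h2 : ∀ j l, formCoord (some (some (j, l))) (q : FormSpace N d) = 0 := by
      intro j l
      have h := q.2.1 j l
      rw [hq0, smul_zero] at h
      exact h.unique HasWeakPartial.zero
    have h3 := norm_sq_formSpace (q : FormSpace N d)
    simp only [hq0, h1, h2, norm_zero] at h3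
    simpa using h3
  -- The range of `J` contains the test functions.
  have hJd : ∀ y, (∀ q, inner ℂ (J q) y = 0) → y = 0 := by
    intro y hy
    refine eq_zero_of_inner_testVec fun f hf hfc => ?_
    obtain ⟨q, hq, hqf⟩ := exists_mem_formGraph c hW0 hWm (testVec_mem_freeFormDomain hW hf hfc)
    rw [← hqf]
    exact hy ⟨q, hq⟩
  obtain ⟨R, U, hRpos, hUn, hUs, hRU⟩ := exists_isPositive_eq_comp_isometry J hJ hJd
  have hR : ∀ φ, R φ = formCoord none (U φ : FormSpace N d) := fun φ => by rw [hRU]; rfl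
  -- `U φ` is the graph point above `R φ`, so its other coordinates are `√W R φ` and the derivatives
  -- of `R φ`, the latter still carrying the weight `√cⱼ`.
  refine ⟨R, fun j l => ((√(c j) : ℝ) : ℂ)⁻¹ • (formCoord (some (some (j, l))) ∘L Q.subtypeL ∘L U),
    formCoord (some none) ∘L Q.subtypeL ∘L U, hRpos, ?_, ?_, ?_, ?_⟩
  · ext ψ
    constructor
    · rintro ⟨φ, rfl⟩
      rw [hR]
      exact formGraph_mem_freeFormDomain hc hW0 (U φ).2
    · intro hψ
      obtain ⟨q, hq, rfl⟩ := exists_mem_formGraph c hW0 hWm hψ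
      obtain ⟨φ, hφ⟩ := hUs ⟨q, hq⟩
      exact ⟨φ, by rw [hR, hφ]⟩
  · intro φ
    rw [hR, freeFormOf_formCoord hc hW0 (U φ).2, ← hUn φ]
    rfl
  · intro φ j l
    rw [hR, (formGraph_hasWeakPartial hc (U φ).2 j l).weakPartial_eq]
    rfl
  · intro φ
    rw [hR]
    exact integral_potential_eq_norm_sq hW0 (formGraph_sqrt_potential (U φ).2)

end FormDomain

/-! ## Bounded quadratic forms -/

section BoundedForms

variable {H : Type*} [NormedAddCommGroup H] [InnerProductSpace ℂ H]

/-- `q` is the quadratic form of a bounded operator. -/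
def IsBoundedForm (q : H → ℝ) : Prop :=
  ∃ G : H →L[ℂ] H, ∀ φ, inner ℂ φ (G φ) = ((q φ : ℝ) : ℂ)

namespace IsBoundedForm

theorem add {p q : H → ℝ} (hp : IsBoundedForm p) (hq : IsBoundedForm q) :
    IsBoundedForm fun φ => p φ + q φ := by
  obtain ⟨A, hA⟩ := hp
  obtain ⟨B, hB⟩ := hq
  exact ⟨A + B, fun φ => by simp [hA, hB]⟩

theorem const_mul {q : H → ℝ} (a : ℝ) (hq : IsBoundedForm q) :
    IsBoundedForm fun φ => a * q φ := by
  obtain ⟨A, hA⟩ := hq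
  exact ⟨(a : ℂ) • A, fun φ => by
    rw [smul_apply, inner_smul_right, hA, Complex.ofReal_mul]⟩

theorem sub {p q : H → ℝ} (hp : IsBoundedForm p) (hq : IsBoundedForm q) :
    IsBoundedForm fun φ => p φ - q φ := by
  simpa [sub_eq_add_neg] using hp.add (hq.const_mul (-1))

theorem sum {ι : Type*} (s : Finset ι) {q : ι → H → ℝ} (hq : ∀ i, IsBoundedForm (q i)) :
    IsBoundedForm fun φ => ∑ i ∈ s, q i φ := by
  choose A hA using hq
  exact ⟨∑ i ∈ s, A i, fun φ => by simp [hA]⟩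

/-- The operator is the self-adjoint part `(A* B + B* A) / 2` of `A* B`. -/
theorem re_inner [CompleteSpace H] {K : Type*} [NormedAddCommGroup K] [InnerProductSpace ℂ K]
    [CompleteSpace K] (A B : H →L[ℂ] K) : IsBoundedForm fun φ => (inner ℂ (A φ) (B φ)).re := by
  refine ⟨(2⁻¹ : ℂ) • (A.adjoint ∘L B + B.adjoint ∘L A), fun φ => ?_⟩
  rw [smul_apply, inner_smul_right, add_apply, inner_add_right, ContinuousLinearMap.comp_apply,
    ContinuousLinearMap.comp_apply, ContinuousLinearMap.adjoint_inner_right,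
    ContinuousLinearMap.adjoint_inner_right, ← inner_conj_symm (B φ) (A φ), Complex.add_conj]
  push_cast
  ring

theorem norm_sq [CompleteSpace H] {K : Type*} [NormedAddCommGroup K] [InnerProductSpace ℂ K]
    [CompleteSpace K] (A : H →L[ℂ] K) : IsBoundedForm fun φ => ‖A φ‖ ^ 2 := by
  have h := re_inner A A
  simpa only [← RCLike.re_to_complex, inner_self_eq_norm_sq] using h

end IsBoundedForm

end BoundedForms

/-! ## Functions of one particle -/

section OneParticle

variable {N d : ℕ}

/-- Null sets of one-particle positions pull back to null sets of configurations, so an essential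
bound survives the composition. -/
theorem memLp_top_comp_particle {f : EuclideanSpace ℝ (Fin d) → ℝ} (hf : MemLp f ⊤ volume)
    (j : Fin N) : MemLp (fun X : Config N d => f (X j)) ⊤ volume := by
  have hq : Measure.QuasiMeasurePreserving (fun X : Config N d => X j) volume volume :=
    Measure.quasiMeasurePreserving_eval _ j
  have hb : ∀ᵐ x, ‖f x‖ ≤ (eLpNorm f ⊤ volume).toReal := by
    rw [eLpNorm_exponent_top]
    have h := hf.2
    rw [eLpNorm_exponent_top] at h
    filter_upwards [ae_le_eLpNormEssSup (f := f) (μ := volume)] with x hx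
    rw [← toReal_enorm]
    exact ENNReal.toReal_mono h.ne hx
  exact memLp_top_of_bound (hf.1.comp_quasiMeasurePreserving hq) _ (hq.ae hb)

theorem memLp_top_two_re_inner {h : Type*} [NormedAddCommGroup h] [InnerProductSpace ℂ h]
    {xi : EuclideanSpace ℝ (Fin d) → h} (hxi : MemLp xi ⊤ volume) (a : h) :
    MemLp (fun x => 2 * (inner ℂ a (xi x)).re) ⊤ volume :=
  (hxi.const_inner (𝕜 := ℂ) a).re.const_mul 2

/-- A Fourier integral `∫_S conj z(k) e^{-ik·x} w(k) dk` is measurable in `x`. -/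
theorem stronglyMeasurable_fourierIntegral (z : PolaronField d)
    {w : EuclideanSpace ℝ (Fin d) → ℝ} (hw : Measurable w) (S : Set (EuclideanSpace ℝ (Fin d))) :
    StronglyMeasurable fun x : EuclideanSpace ℝ (Fin d) => ∫ k in S,
      conj (z k) * Complex.exp (-Complex.I * ((inner ℝ k x : ℝ) : ℂ)) * ((w k : ℝ) : ℂ) := by
  refine StronglyMeasurable.integral_prod_right' (ν := volume.restrict S)
    (f := fun p : EuclideanSpace ℝ (Fin d) × EuclideanSpace ℝ (Fin d) =>
      conj (z p.2) * Complex.exp (-Complex.I * ((inner ℝ p.2 p.1 : ℝ) : ℂ)) * ((w p.2 : ℝ) : ℂ)) ?_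
  have h1 : StronglyMeasurable fun p : EuclideanSpace ℝ (Fin d) × EuclideanSpace ℝ (Fin d) =>
      conj (z p.2) :=
    Complex.continuous_conj.comp_stronglyMeasurable
      ((Lp.stronglyMeasurable z).comp_measurable measurable_snd)
  have h2 : StronglyMeasurable fun p : EuclideanSpace ℝ (Fin d) × EuclideanSpace ℝ (Fin d) =>
      Complex.exp (-Complex.I * ((inner ℝ p.2 p.1 : ℝ) : ℂ)) :=
    Continuous.stronglyMeasurable (by fun_prop)
  have h3 : StronglyMeasurable fun p : EuclideanSpace ℝ (Fin d) × EuclideanSpace ℝ (Fin d) =>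
      ((w p.2 : ℝ) : ℂ) :=
    (Complex.measurable_ofReal.comp (hw.comp measurable_snd)).stronglyMeasurable
  exact (h1.mul h2).mul h3

/-- The phase has modulus one, so the bound does not depend on `x`. The norm inequality for Bochner
integrals holds without any integrability check on the weight. -/
theorem norm_fourierIntegral_le (z : PolaronField d) (w : EuclideanSpace ℝ (Fin d) → ℝ)
    (S : Set (EuclideanSpace ℝ (Fin d))) (x : EuclideanSpace ℝ (Fin d)) :
    ‖∫ k in S, conj (z k) * Complex.exp (-Complex.I * ((inner ℝ k x : ℝ) : ℂ)) * ((w k : ℝ) : ℂ)‖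
      ≤ ∫ k in S, ‖z k‖ * |w k| := by
  refine (norm_integral_le_integral_norm _).trans_eq ?_
  congr with k
  rw [norm_mul, norm_mul, RCLike.norm_conj, Complex.norm_real, Complex.norm_exp]
  simp

theorem memLp_top_polaronLow (r : ℝ) (z : PolaronField d) :
    MemLp (polaronLow r z) ⊤ volume := by
  have hw : Measurable fun k : EuclideanSpace ℝ (Fin d) => ‖k‖ ^ (-((d : ℝ) - 1) / 2) := by
    fun_prop
  refine memLp_top_of_abs_le ?_ (|2| * ∫ k in {k : EuclideanSpace ℝ (Fin d) | ‖k‖ ≤ r},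
    ‖z k‖ * |‖k‖ ^ (-((d : ℝ) - 1) / 2)|) fun x => ?_
  · exact ((Complex.continuous_re.comp_stronglyMeasurable
      (stronglyMeasurable_fourierIntegral z hw _)).const_mul 2).aestronglyMeasurable
  · rw [polaronLow, abs_mul]
    exact mul_le_mul_of_nonneg_left
      ((Complex.abs_re_le_norm _).trans (norm_fourierIntegral_le z _ _ x)) (abs_nonneg _)

theorem memLp_top_polaronHigh (r : ℝ) (z : PolaronField d) (l : Fin d) :
    MemLp (polaronHigh r z l) ⊤ volume := by
  have hw : Measurable fun k : EuclideanSpace ℝ (Fin d) =>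
      ‖k‖ ^ (-((d : ℝ) + 1) / 2) * (k l / ‖k‖) := by
    fun_prop
  refine memLp_top_of_abs_le ?_ (|-2| * ∫ k in {k : EuclideanSpace ℝ (Fin d) | r < ‖k‖},
    ‖z k‖ * |‖k‖ ^ (-((d : ℝ) + 1) / 2) * (k l / ‖k‖)|) fun x => ?_
  · exact ((Complex.continuous_im.comp_stronglyMeasurable
      (stronglyMeasurable_fourierIntegral z hw _)).const_mul (-2)).aestronglyMeasurable
  · rw [polaronHigh, abs_mul]
    exact mul_le_mul_of_nonneg_left
      ((Complex.abs_im_le_norm _).trans (norm_fourierIntegral_le z _ _ x)) (abs_nonneg _)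

/-- The form of a bounded one-particle potential. -/
theorem isBoundedForm_potential {f : EuclideanSpace ℝ (Fin d) → ℝ} (hf : MemLp f ⊤ volume)
    (R : ParticleSpace N d →L[ℂ] ParticleSpace N d) (j : Fin N) :
    IsBoundedForm fun φ => ∫ X, f (X j) * ‖R φ X‖ ^ 2 := by
  have h := IsBoundedForm.re_inner R (mulOp _ (memLp_top_comp_particle hf j) ∘L R)
  simpa only [ContinuousLinearMap.comp_apply, re_inner_mulOp_self] using h

/-- The form of a bounded one-particle vector field times a derivative. -/
theorem isBoundedForm_drift {f : EuclideanSpace ℝ (Fin d) → ℝ} (hf : MemLp f ⊤ volume)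
    (R D : ParticleSpace N d →L[ℂ] ParticleSpace N d) (j : Fin N) :
    IsBoundedForm fun φ => ∫ X, f (X j) * (conj (R φ X) * D φ X).re := by
  have h := IsBoundedForm.re_inner R (mulOp _ (memLp_top_comp_particle hf j) ∘L D)
  simpa only [ContinuousLinearMap.comp_apply, re_inner_mulOp] using h

/-- The form of the square of a magnetic derivative with a bounded vector potential. -/
theorem isBoundedForm_magnetic {f : EuclideanSpace ℝ (Fin d) → ℝ} (hf : MemLp f ⊤ volume)
    (R D : ParticleSpace N d →L[ℂ] ParticleSpace N d) (j : Fin N) :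
    IsBoundedForm fun φ => ∫ X, ‖-Complex.I * D φ X + ((f (X j) : ℝ) : ℂ) * R φ X‖ ^ 2 := by
  -- The square is left unexpanded: it is the squared norm of one bounded operator applied to `φ`.
  have h := IsBoundedForm.norm_sq
    ((-Complex.I) • D + mulOp _ (memLp_top_comp_particle hf j) ∘L R)
  convert h using 2 with φ
  rw [Lp_norm_sq_eq_integral]
  refine integral_congr_ae ?_
  filter_upwards [Lp.coeFn_add ((-Complex.I) • D φ)
      (mulOp _ (memLp_top_comp_particle hf j) (R φ)), Lp.coeFn_smul (-Complex.I) (D φ),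
    coeFn_mulOp (memLp_top_comp_particle hf j) (R φ)] with X h1 h2 h3
  rw [add_apply, smul_apply, ContinuousLinearMap.comp_apply, h1, Pi.add_apply, h2, h3,
    Pi.smul_apply, smul_eq_mul]

/-- The form of the free operator is bounded relative to itself. -/
theorem isBoundedForm_freeFormOf {c : Fin N → ℝ} {W : Config N d → ℝ}
    {R Y : ParticleSpace N d →L[ℂ] ParticleSpace N d}
    {D : Fin N → Fin d → ParticleSpace N d →L[ℂ] ParticleSpace N d}
    (hD : ∀ φ j l, weakPartial (R φ) j l = D j l φ)
    (hY : ∀ φ, ∫ X, W X * ‖R φ X‖ ^ 2 = ‖Y φ‖ ^ 2) :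
    IsBoundedForm fun φ => freeFormOf c W (R φ) := by
  simp only [freeFormOf, hD, hY]
  exact (IsBoundedForm.sum _ fun j => (IsBoundedForm.sum _ fun l =>
    IsBoundedForm.norm_sq _).const_mul _).add (IsBoundedForm.norm_sq _)

end OneParticle

/-! ## The three models -/

/-- The Borel structure makes points measurable, as the point masses in `energies_eq` require. -/
instance {h : Type*} [NormedAddCommGroup h] [InnerProductSpace ℂ h] [CompleteSpace h]
    (ω : Dispersion h) : BorelSpace ω.PhaseSpace := ⟨rfl⟩

instance (d : ℕ) : BorelSpace (PolaronField d) := ⟨rfl⟩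

section Models

variable {h : Type*} [NormedAddCommGroup h] [InnerProductSpace ℂ h] [CompleteSpace h]
  {ω : Dispersion h} {N d : ℕ}

/-- A sandwich operator exists precisely when `φ ↦ ⟨Rφ|ℋ_z|Rφ⟩` is an `IsBoundedForm`; here the
potential is bounded because `ω^{-1/2} λ` is essentially bounded. -/
theorem nelsonModel_exists_sandwich {W : Config N d → ℝ} (hW : LocallyIntegrable W volume)
    (hW0 : ∀ᵐ X, 0 ≤ W X) (F : NelsonFormFactor ω d) :
    ∃ R, (nelsonModel W F).IsInvSqrt R ∧ ∀ z, ∃ G, (nelsonModel W F).IsSandwich R z G := by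
  obtain ⟨R, D, Y, hR, hran, hfree, hD, hY⟩ :=
    exists_inverse_sqrt_free (c := fun _ : Fin N => 1) (fun _ => one_pos) hW hW0
  refine ⟨R, ⟨hR, hran, hfree⟩, fun z => ?_⟩
  exact ((isBoundedForm_freeFormOf hD hY).add (IsBoundedForm.sum _ fun j =>
    isBoundedForm_potential (memLp_top_two_re_inner F.memLp_xi _) R j)).add
    ((IsBoundedForm.norm_sq R).const_mul _)

/-- The high-momentum part enters only through a bounded field times a derivative of `R φ`, and `∂R`
is bounded. -/
theorem polaronModel_exists_sandwich {W : Config N d → ℝ} (hW : LocallyIntegrable W volume)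
    (hW0 : ∀ᵐ X, 0 ≤ W X) (α r : ℝ) :
    ∃ R, (polaronModel W α r).IsInvSqrt R ∧ ∀ z, ∃ G, (polaronModel W α r).IsSandwich R z G := by
  obtain ⟨R, D, Y, hR, hran, hfree, hD, hY⟩ :=
    exists_inverse_sqrt_free (c := fun _ : Fin N => 1) (fun _ => one_pos) hW hW0
  refine ⟨R, ⟨hR, hran, hfree⟩, fun z => ?_⟩
  have h := ((isBoundedForm_freeFormOf (c := fun _ => 1) hD hY).add
    ((IsBoundedForm.sum Finset.univ fun j =>
      (isBoundedForm_potential (memLp_top_polaronLow r z) R j).sub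
        ((IsBoundedForm.sum Finset.univ fun l =>
          isBoundedForm_drift (memLp_top_polaronHigh r z l) R (D j l) j).const_mul 2)).const_mul
      (√α))).add ((IsBoundedForm.norm_sq R).const_mul (‖z‖ ^ 2))
  simp only [← hD] at h
  exact h

theorem pauliFierzModel_exists_sandwich {W : Config N 3 → ℝ} (hW : LocallyIntegrable W volume)
    (hW0 : ∀ᵐ X, 0 ≤ W X) {mass : Fin N → ℝ} (hmass : ∀ j, 0 < mass j) (e : ℝ)
    (F : PauliFierzFormFactor ω N) :
    ∃ R, (pauliFierzModel W mass e F).IsInvSqrt R ∧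
      ∀ z, ∃ G, (pauliFierzModel W mass e F).IsSandwich R z G := by
  have hc : ∀ j, 0 < 1 / (2 * mass j) := fun j => by have := hmass j; positivity
  obtain ⟨R, D, Y, hR, hran, hfree, hD, hY⟩ := exists_inverse_sqrt_free hc hW hW0
  refine ⟨R, ⟨hR, hran, hfree⟩, fun z => ?_⟩
  have h := ((IsBoundedForm.sum Finset.univ fun j => (IsBoundedForm.sum Finset.univ fun l =>
    isBoundedForm_magnetic ((memLp_top_two_re_inner (F.memLp_xi j l) (ω.sqrtExt z)).const_mul e)
      R (D j l) j).const_mul (1 / (2 * mass j))).add (IsBoundedForm.norm_sq Y)).add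
    ((IsBoundedForm.norm_sq R).const_mul (‖z‖ ^ 2))
  -- Boundedness was shown with the operators `D` and `Y`; this returns to weak derivatives and `∫ W
  -- |Rφ|²`.
  simp only [← hD, ← hY] at h
  exact h

end Models

theorem mainTheorem11 {h : Type*} [NormedAddCommGroup h] [InnerProductSpace ℂ h]
    [CompleteSpace h] (ω : Dispersion h) (N : ℕ) :
    -- Nelson model
    (∀ (d : ℕ), d = 1 ∨ d = 2 ∨ d = 3 → ∀ (W : Config N d → ℝ), LocallyIntegrable W volume →
      (∀ᵐ X, 0 ≤ W X) → ∀ (F : NelsonFormFactor ω d),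
      (nelsonModel W F).energyQC = (nelsonModel W F).energyGQC ∧
      (nelsonModel W F).energyGQC = (nelsonModel W F).energyGSVM ∧
      (nelsonModel W F).energyGQCPure = (nelsonModel W F).energyQC) ∧
    -- polaron
    (∀ (d : ℕ), d = 1 ∨ d = 2 ∨ d = 3 → ∀ (W : Config N d → ℝ), LocallyIntegrable W volume →
      (∀ᵐ X, 0 ≤ W X) → ∀ (α r : ℝ), 0 < α → 0 < r →
      (polaronModel W α r).energyQC = (polaronModel W α r).energyGQC ∧
      (polaronModel W α r).energyGQC = (polaronModel W α r).energyGSVM ∧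
      (polaronModel W α r).energyGQCPure = (polaronModel W α r).energyQC) ∧
    -- Pauli-Fierz model
    (∀ (W : Config N 3 → ℝ), LocallyIntegrable W volume → (∀ᵐ X, 0 ≤ W X) →
      ∀ (mass : Fin N → ℝ) (e : ℝ) (F : PauliFierzFormFactor ω N), (∀ j, 0 < mass j) →
      (pauliFierzModel W mass e F).energyQC = (pauliFierzModel W mass e F).energyGQC ∧
      (pauliFierzModel W mass e F).energyGQC = (pauliFierzModel W mass e F).energyGSVM ∧
      (pauliFierzModel W mass e F).energyGQCPure = (pauliFierzModel W mass e F).energyQC) :=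
  ⟨fun _ _ _ hW hW0 F => QuasiClassicalForms.energies_eq (nelsonModel_exists_sandwich hW hW0 F),
    fun _ _ _ hW hW0 α r _ _ =>
      QuasiClassicalForms.energies_eq (polaronModel_exists_sandwich hW hW0 α r),
    fun _ hW hW0 _ e F hmass =>
      QuasiClassicalForms.energies_eq (pauliFierzModel_exists_sandwich hW hW0 hmass e F)⟩
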